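/- Let $k$ be an algebraically closed field of characteristic $p>3$, let $A=k[X]/(X^p)$, let $x$ be the class of $X$, and let $W=\mathrm{Der}_k(A)$ be the Witt algebra, with basis $e_i=x^{i+1}\partial$ ($-1\le i\le p-2$), where $\partial=d/dx$. Let $W^*$ be the dual space with dual basis $e_{-1}',\dots,e_{p-2}'$, and let $G=\mathrm{Aut}(W)$ be the group of Lie algebra automorphisms of $W$, acting on $W^*$ by $(g\cdot\chi)(w)=\chi(g^{-1}(w))$. Put $W_{\ge i}=\bigoplus_{j\ge i}ke_j$. The height $r(\chi)$ of $\chi\in W^*$ is $p-1$ if $\chi(e_{p-2})\ne0$, and otherwise it is $\min\{i\in\{-1,\dots,p-2\}\mid \chi|_{W_{\ge i}}=0\}$. For $j\in\mathbb N$ let $k^{(j)}\subseteq k$ be any set of representatives for the classes of the equivalence relation $x\sim y\Leftrightarrow x^j=y^j$ on $k$. Then the height is constant on $G$-orbits, and a set of representatives for the $G$-orbits of height $i$ in $W^*$ (i.e. a set of characters of height $i$ that meets each orbit of height $i$ in exactly one point) is: 1. $\{ae_0'\mid a\in k^*\}$ if $i=1$; 2. $\{e_{i-1}'\}$ if $0\le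 i\le p-3$ and $i$ is even; 3. $\{e_{i-1}'+ae_{\frac{i-1}{2}}'\mid a\in k^{(2)}\}$ if $3\le i\le p-2$ and $i$ is odd; 4. $\{e_{p-2}'+ae_{-1}'\mid a\in k^{(p-2)}\}$ if $i=p-1$. Furthermore, the dimensions of the orbits (as subspaces of $W^*$ in the Zariski topology) are: 1. $\dim G(ae_0')=1$ for $a\in k^*$; 2. $\dim Ge_{i-1}'=i+1$ if $0\le i\le p-3$ and $i$ is even; 3. $\dim G(e_{i-1}'+ae_{\frac{i-1}{2}}')=i$ for all $a\in k$, if $3\le i\le p-2$ and $i$ is odd; 4. $\dim G(e_{p-2}'+ae_{-1}')=p-1$ for all $a\in k$. -/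

import Mathlib

open Polynomial

noncomputable section

namespace WittAlgebra

variable (k : Type*) [Field k] (p : ℕ)

/-- The truncated polynomial ring `A(1) = k[X] / (X ^ p)`. -/
abbrev TruncPoly : Type _ := AdjoinRoot (X ^ p : k[X])

/-- The class `x` of the variable `X` in `A(1)`. -/
abbrev x : TruncPoly k p := AdjoinRoot.root (X ^ p : k[X])

/-- The Witt algebra: the Lie algebra of `k`-linear derivations of `A(1)`,
with the commutator bracket. -/
abbrev W : Type _ := Derivation k (TruncPoly k p) (TruncPoly k p)

theorem mk_derivative_eq_zero [CharP k p] (f : k[X])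
    (hf : AdjoinRoot.mkₐ (X ^ p : k[X]) f = 0) :
    AdjoinRoot.mkₐ (X ^ p : k[X]) (Polynomial.derivative' f) = 0 := by
  have h : (X ^ p : k[X]) ∣ f := AdjoinRoot.mk_eq_zero.mp hf
  obtain ⟨g, rfl⟩ := h
  refine AdjoinRoot.mk_eq_zero.mpr ⟨derivative g, ?_⟩
  change derivative (X ^ p * g) = _
  simp [derivative_mul, derivative_X_pow]

/-- The derivation `∂ = d/dx` of `A(1)`, induced by the formal derivative of polynomials
(well defined since `k` has characteristic `p`). -/
def del [CharP k p] : W k p :=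
  Derivation.liftOfSurjective (f := AdjoinRoot.mkₐ (X ^ p : k[X])) (AdjoinRoot.mk_surjective)
    (d := Polynomial.derivative') (mk_derivative_eq_zero k p)

theorem del_mk [CharP k p] (f : k[X]) :
    del k p (AdjoinRoot.mk (X ^ p) f) = AdjoinRoot.mk (X ^ p) (derivative f) :=
  Derivation.liftOfSurjective_apply (f := AdjoinRoot.mkₐ (X ^ p : k[X])) AdjoinRoot.mk_surjective
    (mk_derivative_eq_zero k p) f

theorem del_x [CharP k p] : del k p (x k p) = 1 := by
  have := del_mk k p X
  simpa using this

/-- Two derivations of `A(1)` that agree at `x` are equal. -/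
theorem W_ext {D E : W k p} (h : D (x k p) = E (x k p)) : D = E := by
  ext a
  obtain ⟨f, rfl⟩ := AdjoinRoot.mk_surjective a
  have hf : AdjoinRoot.mk (X ^ p) f = Polynomial.aeval (x k p) f := by
    simp [AdjoinRoot.aeval_eq]
  rw [hf, Derivation.map_aeval, Derivation.map_aeval, h]

/-- `D ↦ D(x)` is a linear isomorphism from `W` to `A(1)`, with inverse `a ↦ a ∂`. -/
def evalX [CharP k p] : W k p ≃ₗ[k] TruncPoly k p where
  toFun D := D (x k p)
  map_add' _ _ := rfl
  map_smul' _ _ := rfl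
  invFun a := a • del k p
  left_inv D := W_ext k p (by simp [del_x])
  right_inv a := by simp [del_x]

/-- The basis `1, x, …, x ^ (p - 1)` of `A(1)`. -/
def truncBasis : Module.Basis (Fin p) k (TruncPoly k p) :=
  (AdjoinRoot.powerBasis' (monic_X_pow (R := k) p)).basis.reindex (finCongr (by simp))

theorem truncBasis_apply (n : Fin p) : truncBasis k p n = x k p ^ (n : ℕ) := by
  simp [truncBasis]

/-- The basis of `W` whose `n`-th member, for `0 ≤ n < p`, is `x ^ n ∂`. -/
def basis [CharP k p] : Module.Basis (Fin p) k (W k p) :=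
  (truncBasis k p).map (evalX k p).symm

theorem basis_apply [CharP k p] (n : Fin p) : basis k p n = x k p ^ (n : ℕ) • del k p := by
  simp [basis, truncBasis_apply, evalX]

/-- The element `e_i = x ^ (i + 1) ∂` of `W`, for an integer `i` with `-1 ≤ i ≤ p - 2`.
(For other `i` the value is `0` and is not used.) -/
def e [CharP k p] (i : ℤ) : W k p :=
  if -1 ≤ i ∧ i ≤ (p : ℤ) - 2 then x k p ^ (i + 1).toNat • del k p else 0

/-- The functional `e_i'`, for `-1 ≤ i ≤ p - 2`: the member dual to `e_i` of the basis
of `W*` dual to `e_{-1}, …, e_{p-2}`. (For other `i` the value is `0` and is not used.) -/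
def e' [CharP k p] (i : ℤ) : Module.Dual k (W k p) :=
  if h : -1 ≤ i ∧ i ≤ (p : ℤ) - 2 then (basis k p).coord ⟨(i + 1).toNat, by omega⟩ else 0

/-- The defining property of the dual basis. -/
theorem e'_e [CharP k p] {i j : ℤ} (hi : -1 ≤ i ∧ i ≤ (p : ℤ) - 2)
    (hj : -1 ≤ j ∧ j ≤ (p : ℤ) - 2) : e' k p i (e k p j) = if i = j then 1 else 0 := by
  have hej : e k p j = basis k p ⟨(j + 1).toNat, by omega⟩ := by
    rw [basis_apply, e, if_pos hj]
  rw [hej, e', dif_pos hi, Module.Basis.coord_apply, Module.Basis.repr_self, Finsupp.single_apply]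
  refine if_congr ?_ rfl rfl
  rw [Fin.mk.injEq]
  omega

/-- `W_{≥ i}`, the span of the `e_j` with `i ≤ j ≤ p - 2`. -/
def Wge [CharP k p] (i : ℤ) : Submodule k (W k p) :=
  Submodule.span k {w | ∃ j : ℤ, -1 ≤ j ∧ i ≤ j ∧ j ≤ (p : ℤ) - 2 ∧ w = e k p j}

variable {k p}

open Classical in
/-- The height of a character `χ ∈ W*`: the least `i ∈ {-1, …, p - 2}` such that `χ` vanishes on
`W_{≥ i}` if `χ(e_{p-2}) = 0`, and `p - 1` otherwise. -/
def height [CharP k p] (χ : Module.Dual k (W k p)) : ℤ :=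
  if χ (e k p ((p : ℤ) - 2)) = 0 then
    sInf {i : ℤ | -1 ≤ i ∧ i ≤ (p : ℤ) - 2 ∧ ∀ w ∈ Wge k p i, χ w = 0}
  else (p : ℤ) - 1

/-- The action of the automorphism group `G = Aut(W)` on `W*`: `(g · χ)(w) = χ(g⁻¹ w)`. -/
def act (g : W k p ≃ₗ⁅k⁆ W k p) (χ : Module.Dual k (W k p)) : Module.Dual k (W k p) :=
  χ ∘ₗ (g.symm.toLinearEquiv : W k p →ₗ[k] W k p)

theorem act_apply (g : W k p ≃ₗ⁅k⁆ W k p) (χ : Module.Dual k (W k p)) (w : W k p) :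
    act g χ w = χ (g.symm w) := rfl

/-- The orbit of `χ` under `G = Aut(W)`. -/
def orbit (χ : Module.Dual k (W k p)) : Set (Module.Dual k (W k p)) :=
  {ψ | ∃ g : W k p ≃ₗ⁅k⁆ W k p, ψ = act g χ}

/-- `R` is a set of representatives for the orbits of height `i`: every member of `R` has
height `i`, and the orbit of each character of height `i` contains exactly one member of `R`. -/
def IsOrbitRepresentatives [CharP k p] (i : ℤ) (R : Set (Module.Dual k (W k p))) : Prop :=
  (∀ ρ ∈ R, height ρ = i) ∧ ∀ χ, height χ = i → ∃! ρ, ρ ∈ R ∧ ρ ∈ orbit χ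

variable (k) in
/-- `S` is a set of representatives for the classes of the equivalence relation
`a ∼ b ↔ a ^ j = b ^ j` on `k`. -/
def IsPowRepresentatives (j : ℕ) (S : Set k) : Prop :=
  ∀ a : k, ∃! b, b ∈ S ∧ a ^ j = b ^ j

variable (k) in
/-- The set of common zeros in the affine space `k ^ ι` of a set of polynomials. -/
def zeros {ι : Type*} (S : Set (MvPolynomial ι k)) : Set (ι → k) :=
  {v | ∀ f ∈ S, MvPolynomial.eval v f = 0}

variable (k) in
/-- The Zariski topology on the affine space `k ^ ι`: the closed sets are the sets of common
zeros of polynomials. -/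
@[reducible]
def zariski (ι : Type*) : TopologicalSpace (ι → k) :=
  TopologicalSpace.ofClosed {Z | ∃ S : Set (MvPolynomial ι k), Z = zeros k S}
    ⟨{1}, by ext v; simp [zeros]⟩
    (fun A hA => by
      refine ⟨{f | ∃ S : Set (MvPolynomial ι k), zeros k S ∈ A ∧ f ∈ S}, ?_⟩
      ext v
      simp only [Set.mem_sInter, zeros, Set.mem_ofPred_eq]
      constructor
      · rintro h f ⟨S, hS, hf⟩
        exact h _ hS f hf
      · intro h Z hZ
        obtain ⟨S, rfl⟩ := hA hZ
        exact fun f hf => h f ⟨S, hZ, hf⟩)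
    (by
      rintro _ ⟨S, rfl⟩ _ ⟨T, rfl⟩
      refine ⟨{h | ∃ f ∈ S, ∃ g ∈ T, h = f * g}, ?_⟩
      ext v
      simp only [Set.mem_union, zeros, Set.mem_ofPred_eq]
      constructor
      · rintro (h | h) _ ⟨f, hf, g, hg, rfl⟩
        · simp [h f hf]
        · simp [h g hg]
      · intro h
        by_contra! hc
        obtain ⟨⟨f, hf, hfv⟩, g, hg, hgv⟩ := hc
        have := h _ ⟨f, hf, g, hg, rfl⟩
        rw [map_mul, mul_eq_zero] at this
        exact this.elim hfv hgv)

/-- The coordinates of `χ ∈ W*` with respect to `e_{-1}', …, e_{p-2}'`. -/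
def coords [CharP k p] (χ : Module.Dual k (W k p)) : Fin p → k :=
  fun n => χ (basis k p n)

/-- The dimension of a subset `O` of the affine space `W*`: the Krull dimension of the topological
space `O` with the topology induced by the Zariski topology of `W*`. -/
def dim [CharP k p] (O : Set (Module.Dual k (W k p))) : WithBot ℕ∞ :=
  @topologicalKrullDim O
    (TopologicalSpace.induced (fun χ : O => coords (χ : Module.Dual k (W k p)))
      (zariski k (Fin p)))

end WittAlgebra

end

/-! The proof turns characters into quadratic differentials on the truncated line. Every functional
on `W` is `chi q` for a unique `q` in `A(1)`, where `chi q` sends `f ∂` to the residue of `x ^ (-p)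
q f dx`; so `chi q` stands for `x ^ (-p) q (dx)²`, and its height is `p - 1` minus the order of `q`
at `x`.

Every automorphism of `W` comes from a substitution `x ↦ y` with `y = b x + …`, `b ≠ 0`
(`exists_subst_of_lieEquiv`). The reason is that `W_{≥ 0}` is intrinsic: it normalizes the set of
elements `c` with `(ad c)² = 0`. By the change of variables formula for residues
(`cf_last_subst_mul_del`) the group acts by `q ↦ b ^ (-p) q(y) (y')²` (`mem_orbit_chi_iff`).

Let `q` have order `n`. The substitution `x ↦ x + t x ^ (s + 1)` first alters `q` in degree `n + s`,
by `t (n + 2 (s + 1))` times the leading coefficient. Every later coefficient can therefore be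
removed except where `n + 2 (s + 1)` vanishes modulo `p`. With `2 n' ≡ n` modulo `p` this is `s = p
- 1 - n'` (`exists_mem_orbit_normal_form`). Scaling makes the leading coefficient `1`, unless `n = p
- 2`, where it is invariant.

The surviving coefficient is a residue. Write `q = α x ^ n r²` with `r` of constant term `1`; the
square root `x ^ n' r dx` has the coefficient of `x ^ s` in `r` as residue, and `y` multiplies it by
`b ^ s` while `α` becomes `α b ^ (1 - (p - 1 - n))` (`twist_smul_sq`). This determines the orbits
(`mem_orbit_std_iff`): the remaining coefficients of `r` are free, while `α` and the visible residue
depend on a single nonzero parameter. Such a set is birationally and bijectively parametrized by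
affine space minus a hyperplane, which gives its dimension (`dim_of_smul_sq`). -/

set_option linter.unusedSectionVars false

noncomputable section

namespace WittAlgebra

/-! ### Coefficients, orders and units in the truncated polynomial ring. -/

section Coefficients

variable {k : Type*} [Field k] {p : ℕ}

/-- The coefficient of `x ^ n` in an element of `A(1)`, for `n < p` (and `0` for `p ≤ n`). -/
def cf (n : ℕ) : TruncPoly k p →ₗ[k] k :=
  (lcoeff k n).comp (AdjoinRoot.modByMonicHom (monic_X_pow (R := k) p))

theorem cf_mk {n : ℕ} (hn : n < p) (f : k[X]) :
    cf n (AdjoinRoot.mk (X ^ p : k[X]) f) = f.coeff n := by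
  change (f %ₘ X ^ p).coeff n = f.coeff n
  conv_rhs => rw [← modByMonic_add_div f (X ^ p : k[X])]
  rw [coeff_add, coeff_X_pow_mul', if_neg (by omega), add_zero]

theorem cf_of_le {n : ℕ} (hn : p ≤ n) (a : TruncPoly k p) : cf n a = 0 := by
  obtain ⟨f, rfl⟩ := AdjoinRoot.mk_surjective a
  change (f %ₘ X ^ p).coeff n = 0
  apply coeff_eq_zero_of_degree_lt
  refine (degree_modByMonic_lt f (monic_X_pow p)).trans_le ?_
  rw [degree_X_pow]
  exact_mod_cast hn

theorem cf_ext {a b : TruncPoly k p} (h : ∀ n < p, cf n a = cf n b) : a = b := by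
  obtain ⟨f, rfl⟩ := AdjoinRoot.mk_surjective a
  obtain ⟨g, rfl⟩ := AdjoinRoot.mk_surjective b
  rw [AdjoinRoot.mk_eq_mk, X_pow_dvd_iff]
  intro n hn
  rw [coeff_sub, ← cf_mk hn, ← cf_mk hn, h n hn, sub_self]

theorem cf_mul {n : ℕ} (hn : n < p) (a b : TruncPoly k p) :
    cf n (a * b) = ∑ m ∈ Finset.HasAntidiagonal.antidiagonal n, cf m.1 a * cf m.2 b := by
  obtain ⟨f, rfl⟩ := AdjoinRoot.mk_surjective a
  obtain ⟨g, rfl⟩ := AdjoinRoot.mk_surjective b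
  rw [← map_mul, cf_mk hn, coeff_mul]
  refine Finset.sum_congr rfl fun m hm => ?_
  have := Finset.HasAntidiagonal.mem_antidiagonal.mp hm
  rw [cf_mk (by omega), cf_mk (by omega)]

theorem cf_x_pow {n : ℕ} (hn : n < p) (m : ℕ) :
    cf n (x k p ^ m) = if n = m then 1 else 0 := by
  have : x k p ^ m = AdjoinRoot.mk (X ^ p : k[X]) (X ^ m) := by simp
  rw [this, cf_mk hn, coeff_X_pow]

theorem cf_x_pow_mul {n : ℕ} (hn : n < p) (m : ℕ) (a : TruncPoly k p) :
    cf n (x k p ^ m * a) = if m ≤ n then cf (n - m) a else 0 := by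
  obtain ⟨f, rfl⟩ := AdjoinRoot.mk_surjective a
  have : x k p ^ m * AdjoinRoot.mk (X ^ p : k[X]) f = AdjoinRoot.mk (X ^ p : k[X]) (X ^ m * f) := by
    simp
  rw [this, cf_mk hn, coeff_X_pow_mul', cf_mk (by omega)]

theorem x_pow_self : x k p ^ p = 0 := by
  have : x k p ^ p = AdjoinRoot.mk (X ^ p : k[X]) (X ^ p) := by
    rw [map_pow, AdjoinRoot.mk_X]
  rw [this, AdjoinRoot.mk_self]

theorem x_pow_eq_zero {n : ℕ} (hn : p ≤ n) : x k p ^ n = 0 :=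
  pow_eq_zero_of_le hn x_pow_self

theorem x_pow_dvd_iff {m : ℕ} (hm : m ≤ p) (a : TruncPoly k p) :
    x k p ^ m ∣ a ↔ ∀ n < m, cf n a = 0 := by
  constructor
  · rintro ⟨b, rfl⟩ n hn
    rw [cf_x_pow_mul (by omega), if_neg (by omega)]
  · intro h
    obtain ⟨f, rfl⟩ := AdjoinRoot.mk_surjective a
    have : X ^ m ∣ f := X_pow_dvd_iff.mpr fun n hn => by rw [← cf_mk (p := p) (by omega), h n hn]
    simpa using map_dvd (AdjoinRoot.mk (X ^ p : k[X])) this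

theorem cf_sum_smul {n N : ℕ} (hn : n < p) (c : ℕ → k) :
    cf n (∑ j ∈ Finset.range N, c j • x k p ^ j) = if n < N then c n else 0 := by
  rw [map_sum]
  simp only [map_smul, cf_x_pow hn, smul_eq_mul, mul_ite, mul_one, mul_zero,
    Finset.sum_ite_eq, Finset.mem_range]

theorem eq_sum_smul (a : TruncPoly k p) : a = ∑ j ∈ Finset.range p, cf j a • x k p ^ j :=
  cf_ext fun n hn => by rw [cf_sum_smul hn, if_pos hn]

variable [Fact p.Prime]

theorem prime_pos : 0 < p := (Fact.out : p.Prime).pos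

theorem cf_zero_mul (a b : TruncPoly k p) : cf 0 (a * b) = cf 0 a * cf 0 b := by
  simp [cf_mul (prime_pos (p := p))]

theorem cf_zero_one : cf 0 (1 : TruncPoly k p) = 1 := by
  simpa using cf_x_pow (k := k) (prime_pos (p := p)) 0

theorem cf_zero_pow (a : TruncPoly k p) (n : ℕ) : cf 0 (a ^ n) = cf 0 a ^ n := by
  induction n with
  | zero => simp [cf_zero_one]
  | succ n ih => rw [pow_succ, cf_zero_mul, ih, pow_succ]

theorem x_dvd_iff (a : TruncPoly k p) : x k p ∣ a ↔ cf 0 a = 0 := by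
  simpa using x_pow_dvd_iff (k := k) (m := 1) (prime_pos (p := p)) a

theorem exists_eq_add_x_mul (a : TruncPoly k p) : ∃ b, a = cf 0 a • 1 + x k p * b := by
  have : x k p ∣ a - cf 0 a • 1 := by
    rw [x_dvd_iff, map_sub, map_smul, cf_zero_one]
    simp
  obtain ⟨b, hb⟩ := this
  exact ⟨b, by rw [← hb]; ring⟩

theorem isUnit_of_cf_zero_ne {a : TruncPoly k p} (ha : cf 0 a ≠ 0) : IsUnit a := by
  obtain ⟨b, hb⟩ := exists_eq_add_x_mul a
  rw [hb]
  refine IsNilpotent.isUnit_add_left_of_commute ⟨p, ?_⟩ ?_ (Commute.all _ _)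
  · rw [mul_pow, x_pow_self, zero_mul]
  · rw [← Algebra.algebraMap_eq_smul_one]
    exact (IsUnit.mk0 _ ha).map _

theorem pow_self_eq_zero {a : TruncPoly k p} (ha : cf 0 a = 0) : a ^ p = 0 := by
  obtain ⟨b, rfl⟩ := (x_dvd_iff a).mpr ha
  rw [mul_pow, x_pow_self, zero_mul]

theorem nontrivial_truncPoly : Nontrivial (TruncPoly k p) :=
  ⟨0, 1, fun h => by simpa [cf_zero_one] using congrArg (cf 0) h⟩

/-- Exact order: if `x ^ n` divides `a` and the coefficient of `x ^ n` in `a` is not zero,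
then `a` is `x ^ n` times a unit. -/
theorem exists_eq_x_pow_mul {n : ℕ} (hn : n < p) {a : TruncPoly k p} (h : x k p ^ n ∣ a) :
    ∃ u, a = x k p ^ n * u ∧ cf 0 u = cf n a := by
  obtain ⟨u, rfl⟩ := h
  exact ⟨u, rfl, by rw [cf_x_pow_mul hn, if_pos le_rfl, Nat.sub_self]⟩

theorem cf_mul_of_dvd {m n : ℕ} (h : m + n < p) {a b : TruncPoly k p} (ha : x k p ^ m ∣ a)
    (hb : x k p ^ n ∣ b) : cf (m + n) (a * b) = cf m a * cf n b := by
  obtain ⟨u, rfl, hu⟩ := exists_eq_x_pow_mul (by omega) ha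
  obtain ⟨v, rfl, hv⟩ := exists_eq_x_pow_mul (by omega) hb
  rw [← hu, ← hv, show x k p ^ m * u * (x k p ^ n * v) = x k p ^ (m + n) * (u * v) by ring,
    cf_x_pow_mul h, if_pos le_rfl, Nat.sub_self, cf_zero_mul]

theorem exists_order {a : TruncPoly k p} (ha : a ≠ 0) :
    ∃ n < p, x k p ^ n ∣ a ∧ cf n a ≠ 0 := by
  classical
  have : ∃ n, n < p ∧ cf n a ≠ 0 := by
    by_contra! h
    exact ha (cf_ext fun n hn => by rw [h n hn, map_zero])
  obtain ⟨h1, h2⟩ := Nat.find_spec this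
  refine ⟨_, h1, (x_pow_dvd_iff h1.le a).mpr fun m hm => ?_, h2⟩
  have := Nat.find_min this hm
  push Not at this
  exact this (by omega)

variable [CharP k p]

theorem charP_truncPoly : CharP (TruncPoly k p) p :=
  have := nontrivial_truncPoly (k := k) (p := p)
  charP_of_injective_algebraMap (algebraMap k (TruncPoly k p)).injective p

/-- Frobenius is additive and kills `x`, so it sees only the constant term. Hence exponents of
elements with constant term `1` matter only modulo `p`, which later allows halving an odd exponent.
-/
theorem pow_self_eq (a : TruncPoly k p) : a ^ p = cf 0 a ^ p • 1 := by
  have := charP_truncPoly (k := k) (p := p)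
  obtain ⟨b, hb⟩ := exists_eq_add_x_mul a
  conv_lhs => rw [hb]
  rw [add_pow_char, mul_pow, x_pow_self, zero_mul, add_zero, _root_.smul_pow, one_pow]

theorem pow_self_eq_one {a : TruncPoly k p} (ha : cf 0 a = 1) : a ^ p = 1 := by
  rw [pow_self_eq, ha, one_pow, one_smul]

theorem natCast_ne_zero {n : ℕ} (h0 : 0 < n) (hn : n < p) : (n : k) ≠ 0 := by
  rw [Ne, CharP.cast_eq_zero_iff k p]
  exact Nat.not_dvd_of_pos_of_lt h0 hn

theorem cf_del {n : ℕ} (hn : n < p) (a : TruncPoly k p) :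
    cf n (del k p a) = (n + 1) * cf (n + 1) a := by
  obtain ⟨f, rfl⟩ := AdjoinRoot.mk_surjective a
  rw [del_mk, cf_mk hn, coeff_derivative]
  rcases Nat.lt_or_ge (n + 1) p with h | h
  · rw [cf_mk h, mul_comm]
  · have h1 : n + 1 = p := by omega
    have : ((n : k) + 1) = 0 := by
      have := CharP.cast_eq_zero k p
      rw [← h1] at this
      exact_mod_cast this
    rw [this, mul_zero, zero_mul]

theorem cf_last_del (a : TruncPoly k p) : cf (p - 1) (del k p a) = 0 := by
  have := prime_pos (p := p)
  rw [cf_del (by omega), cf_of_le (by omega), mul_zero]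

theorem del_x_pow (n : ℕ) : del k p (x k p ^ n) = (n : k) • x k p ^ (n - 1) := by
  rw [Derivation.leibniz_pow, del_x, smul_eq_mul, mul_one, Nat.cast_smul_eq_nsmul]

theorem W_eq (D : W k p) : D = D (x k p) • del k p :=
  W_ext k p (by simp [del_x])

theorem W_apply (D : W k p) (a : TruncPoly k p) : D a = D (x k p) * del k p a := by
  conv_lhs => rw [W_eq D]
  rfl

theorem bracket_apply_x (D E : W k p) :
    ⁅D, E⁆ (x k p) = D (x k p) * del k p (E (x k p)) - E (x k p) * del k p (D (x k p)) := by
  rw [Derivation.commutator_apply, W_apply D (E _), W_apply E (D _)]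

end Coefficients

/-! ### Substitutions of the variable and the residue formula. -/

section Substitution

variable {k : Type*} [Field k] {p : ℕ} [Fact p.Prime]

/-- The endomorphism of `A(1)` that maps `x` to an element `y` without constant term. -/
def subst {y : TruncPoly k p} (hy : cf 0 y = 0) : TruncPoly k p →ₐ[k] TruncPoly k p :=
  AdjoinRoot.liftAlgHom _ (Algebra.ofId k _) y (by simp [pow_self_eq_zero hy])

theorem subst_mk {y : TruncPoly k p} (hy : cf 0 y = 0) (f : k[X]) :
    subst hy (AdjoinRoot.mk _ f) = aeval y f := by
  rw [subst, AdjoinRoot.liftAlgHom_mk]; rfl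

theorem subst_x {y : TruncPoly k p} (hy : cf 0 y = 0) : subst hy (x k p) = y := by
  simp [subst]

theorem cf_zero_subst {y : TruncPoly k p} (hy : cf 0 y = 0) (a : TruncPoly k p) :
    cf 0 (subst hy a) = cf 0 a := by
  obtain ⟨b, hb⟩ := exists_eq_add_x_mul a
  conv_lhs => rw [hb]
  rw [map_add, map_smul, map_one, map_mul, subst_x, map_add, map_smul, cf_zero_one, cf_zero_mul, hy]
  simp

/-- `subst hy a` and `a` differ by a multiple of `y - x`. -/
theorem sub_dvd_subst_sub {y : TruncPoly k p} (hy : cf 0 y = 0) (a : TruncPoly k p) :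
    y - x k p ∣ subst hy a - a := by
  obtain ⟨f, rfl⟩ := AdjoinRoot.mk_surjective a
  have := Polynomial.sub_dvd_eval_sub y (x k p) (f.map (algebraMap k (TruncPoly k p)))
  rw [eval_map_algebraMap, eval_map_algebraMap, AdjoinRoot.aeval_eq] at this
  rwa [subst_mk]

theorem x_pow_dvd_subst {y : TruncPoly k p} (hy : cf 0 y = 0) {n : ℕ} {a : TruncPoly k p}
    (h : x k p ^ n ∣ a) : x k p ^ n ∣ subst hy a := by
  obtain ⟨b, rfl⟩ := h
  rw [map_mul, map_pow, subst_x]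
  exact Dvd.dvd.mul_right (pow_dvd_pow_of_dvd ((x_dvd_iff y).mpr hy) n) _

theorem exists_eq_x_mul {y : TruncPoly k p} (hy : cf 0 y = 0) (hb : cf 1 y ≠ 0) :
    ∃ θ, cf 0 θ = 1 ∧ y = cf 1 y • (x k p * θ) := by
  have hp := (Fact.out : p.Prime).one_lt
  obtain ⟨u, hu, h1⟩ := exists_eq_x_pow_mul (n := 1) hp (a := y) (by
    simpa using (x_dvd_iff y).mpr hy)
  refine ⟨(cf 1 y)⁻¹ • u, by simp [h1, hb], ?_⟩
  rw [mul_smul_comm, smul_smul, mul_inv_cancel₀ hb, one_smul]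
  simpa using hu

variable [CharP k p]

theorem cf_zero_del (y : TruncPoly k p) : cf 0 (del k p y) = cf 1 y := by
  rw [cf_del (prime_pos (p := p))]
  simp

/-- The change of variables formula for the residue at `0` of `x ^ (-p) a dx`. -/
theorem cf_last_subst_mul_del {y : TruncPoly k p} (hy : cf 0 y = 0) (a : TruncPoly k p) :
    cf (p - 1) (subst hy a * del k p y) = cf 1 y ^ p * cf (p - 1) a := by
  have hp := (Fact.out : p.Prime).one_lt
  conv_lhs => rw [eq_sum_smul a]
  rw [map_sum, Finset.sum_mul, map_sum]
  -- Only the monomial of degree `p - 1` contributes: for `n < p - 1` the product `y ^ n y'` is the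
  -- derivative of `y ^ (n + 1) / (n + 1)`, and a derivative has no term in degree `p - 1`.
  rw [Finset.sum_eq_single (p - 1)]
  · rw [map_smul, smul_mul_assoc, map_smul, smul_eq_mul, mul_comm, map_pow, subst_x]
    congr 1
    have h1 := cf_mul_of_dvd (k := k) (m := p - 1) (n := 0) (by omega)
      (pow_dvd_pow_of_dvd ((x_dvd_iff y).mpr hy) (p - 1)) (b := del k p y) (by simp)
    rw [add_zero] at h1
    rw [h1, cf_zero_del]
    obtain ⟨c, hc⟩ := (x_dvd_iff y).mpr hy
    have h2 : cf 1 y = cf 0 c := by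
      have := cf_x_pow_mul hp 1 c
      rw [pow_one, ← hc] at this
      simpa using this
    have h3 : cf (p - 1) (y ^ (p - 1)) = cf 0 c ^ (p - 1) := by
      rw [hc, mul_pow, cf_x_pow_mul (by omega), if_pos le_rfl, Nat.sub_self, cf_zero_pow]
    rw [h2, h3, ← pow_succ]
    congr 1
    omega
  · intro n hn hne
    have hn' := Finset.mem_range.mp hn
    rw [map_smul, smul_mul_assoc, map_smul, map_pow, subst_x]
    have h0 : ((n + 1 : ℕ) : k) ≠ 0 := natCast_ne_zero (p := p) (by omega) (by omega)
    have h1 : y ^ n * del k p y = ((n + 1 : ℕ) : k)⁻¹ • del k p (y ^ (n + 1)) := by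
      rw [Derivation.leibniz_pow, ← Nat.cast_smul_eq_nsmul k, smul_smul, inv_mul_cancel₀ h0,
        one_smul, Nat.add_sub_cancel, smul_eq_mul]
    rw [h1, map_smul, cf_last_del, smul_zero, smul_zero]
  · intro h
    exact absurd (Finset.mem_range.mpr (by omega)) h

end Substitution

/-! ### Automorphisms of the Witt algebra are the substitutions. -/

section Automorphisms

variable {k : Type*} [Field k] {p : ℕ} [Fact p.Prime] [CharP k p]

theorem x_pow_dvd_del {n : ℕ} {a : TruncPoly k p} (h : x k p ^ n ∣ a) :
    x k p ^ (n - 1) ∣ del k p a := by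
  obtain ⟨b, rfl⟩ := h
  rw [Derivation.leibniz, del_x_pow, smul_eq_mul, smul_eq_mul]
  exact dvd_add (Dvd.dvd.mul_right (pow_dvd_pow _ (Nat.sub_le n 1)) _)
    (Dvd.dvd.mul_left (Dvd.intro_left (algebraMap k _ n) (by rw [Algebra.smul_def])) _)

theorem mul_eq_zero_of_dvd {m n : ℕ} (h : p ≤ m + n) {a b : TruncPoly k p} (ha : x k p ^ m ∣ a)
    (hb : x k p ^ n ∣ b) : a * b = 0 := by
  obtain ⟨u, rfl⟩ := ha
  obtain ⟨v, rfl⟩ := hb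
  rw [show x k p ^ m * u * (x k p ^ n * v) = x k p ^ (m + n) * (u * v) by ring,
    x_pow_eq_zero h, zero_mul]

variable (k p) in
/-- The elements `c` of `W` with `(ad c) ^ 2 = 0`. -/
def sandwich : Set (W k p) := {c | ∀ w : W k p, ⁅c, ⁅c, w⁆⁆ = 0}

theorem bracket_bracket_apply_x (c w : W k p) : ⁅c, ⁅c, w⁆⁆ (x k p) =
    c (x k p) * (c (x k p) * del k p (del k p (w (x k p))) -
      w (x k p) * del k p (del k p (c (x k p)))) -
    (c (x k p) * del k p (w (x k p)) - w (x k p) * del k p (c (x k p))) *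
      del k p (c (x k p)) := by
  rw [bracket_apply_x, bracket_apply_x, map_sub, Derivation.leibniz, Derivation.leibniz]
  simp only [smul_eq_mul]
  ring

theorem smul_del_apply_x (a : TruncPoly k p) : (a • del k p) (x k p) = a := by
  simp [del_x]

theorem two_ne_zero_truncPoly (hp : 3 < p) {a : TruncPoly k p} (h : (2 : TruncPoly k p) * a = 0) :
    a = 0 := by
  have h2 : ((2 : ℕ) : k) ≠ 0 := natCast_ne_zero (p := p) (by omega) (by omega)
  have : ((2 : ℕ) : k) • a = 0 := by rw [Nat.cast_smul_eq_nsmul, nsmul_eq_mul]; exact_mod_cast h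
  exact (smul_eq_zero.mp this).resolve_left h2

/-- For `c = f ∂`, the condition `(ad c)² = 0` amounts to `f² = f f' = f'² = f f'' = 0`. The
strongest of these is `f'² = 0`: an order `s` of `f` must satisfy `2 (s - 1) ≥ p`, and `p` is odd.
-/
theorem mem_sandwich_iff (hp : 3 < p) (c : W k p) :
    c ∈ sandwich k p ↔ x k p ^ ((p + 3) / 2) ∣ c (x k p) := by
  have hodd := (Fact.out : p.Prime).eq_two_or_odd
  set f := c (x k p) with hf
  constructor
  · intro h
    -- Testing on `∂`, `x ∂` and `x² ∂` already yields all the relations needed.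
    have e0 := congrArg (fun D : W k p => D (x k p)) (h (del k p))
    have e1 := congrArg (fun D : W k p => D (x k p)) (h (x k p • del k p))
    have e2 := congrArg (fun D : W k p => D (x k p)) (h (x k p ^ 2 • del k p))
    simp only [bracket_bracket_apply_x, smul_del_apply_x, del_x, Derivation.coe_zero,
      Pi.zero_apply, Derivation.map_one_eq_zero, Derivation.leibniz_pow, ← hf, map_nsmul,
      map_zero] at e0 e1 e2
    set f' := del k p f
    set f'' := del k p f' with hf''
    have e1' : f * f' = 0 := by linear_combination -e1 + x k p * e0
    have e2' : f * f = 0 := by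
      apply two_ne_zero_truncPoly hp
      simp only [nsmul_eq_mul, Nat.cast_ofNat, Nat.add_one_sub_one, pow_one, smul_eq_mul, del_x,
        mul_one] at e2
      linear_combination e2 - x k p ^ 2 * e0 + 2 * x k p * e1'
    have e3 : f' * f' = 0 := by
      apply two_ne_zero_truncPoly hp
      have := congrArg (del k p) e1'
      rw [Derivation.leibniz, map_zero, ← hf''] at this
      simp only [smul_eq_mul] at this
      linear_combination this + e0
    rcases eq_or_ne f 0 with h0 | h0
    · rw [h0]; exact dvd_zero _
    obtain ⟨s, hs, hd, hne⟩ := exists_order h0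
    refine (pow_dvd_pow _ ?_).trans hd
    have h1 : p ≤ s + s := by
      by_contra! hlt
      have := cf_mul_of_dvd hlt hd hd
      rw [e2', map_zero] at this
      exact hne (mul_self_eq_zero.mp this.symm)
    have h2 : p ≤ (s - 1) + (s - 1) := by
      by_contra! hlt
      have := cf_mul_of_dvd hlt (x_pow_dvd_del hd) (x_pow_dvd_del hd)
      rw [e3, map_zero, cf_del (by omega), Nat.sub_add_cancel (by omega)] at this
      have h3 := mul_self_eq_zero.mp this.symm
      rcases mul_eq_zero.mp h3 with h4 | h4
      · refine natCast_ne_zero (k := k) (p := p) (n := s) (by omega) hs ?_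
        rw [← h4]
        have : (s : k) = ((s - 1 + 1 : ℕ) : k) := by congr 1; omega
        rw [this]; push_cast; rfl
      · exact hne h4
    omega
  · intro h w
    apply W_ext
    have d1 := x_pow_dvd_del h
    have d2 := x_pow_dvd_del d1
    have h1 : f * f = 0 := mul_eq_zero_of_dvd (by omega) h h
    have h2 : f * del k p f = 0 := mul_eq_zero_of_dvd (by omega) h d1
    have h3 : del k p f * del k p f = 0 := mul_eq_zero_of_dvd (by omega) d1 d1
    have h4 : f * del k p (del k p f) = 0 := mul_eq_zero_of_dvd (by omega) h d2
    rw [bracket_bracket_apply_x, ← hf, Derivation.coe_zero, Pi.zero_apply]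
    linear_combination del k p (del k p (w (x k p))) * h1 - w (x k p) * h4
      - del k p (w (x k p)) * h2 + w (x k p) * h3

/-- The maximal subalgebra `W_{≥ 0}` is the normalizer of the set of sandwich elements. -/
theorem cf_zero_apply_x_iff (hp : 3 < p) (w : W k p) :
    cf 0 (w (x k p)) = 0 ↔ ∀ c ∈ sandwich k p, ⁅w, c⁆ ∈ sandwich k p := by
  have hodd := (Fact.out : p.Prime).eq_two_or_odd
  constructor
  · intro h c hc
    rw [mem_sandwich_iff hp] at hc ⊢
    rw [bracket_apply_x]
    refine dvd_sub ?_ (Dvd.dvd.mul_right hc _)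
    have h1 := mul_dvd_mul ((x_dvd_iff _).mpr h) (x_pow_dvd_del hc)
    rwa [← pow_succ', Nat.sub_add_cancel (by omega)] at h1
  · intro h
    by_contra hne
    obtain ⟨n, hn⟩ : ∃ n, n = (p + 3) / 2 := ⟨_, rfl⟩
    have h1 : x k p ^ n • del k p ∈ sandwich k p := by
      -- The element `x ^ n ∂` has the least order allowed. Bracketing it with a `w` of nonzero
      -- constant term lowers the order to `n - 1`, since `0 < n < p` keeps the factor `n` nonzero;
      -- `n < p` needs `p > 3`.
      rw [mem_sandwich_iff hp, smul_del_apply_x, hn]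
    have h2 := h _ h1
    rw [mem_sandwich_iff hp, ← hn, bracket_apply_x, smul_del_apply_x, del_x_pow,
      x_pow_dvd_iff (by omega)] at h2
    have h3 := h2 (n - 1) (by omega)
    rw [map_sub, cf_x_pow_mul (by omega), if_neg (by omega), sub_zero, mul_smul_comm, map_smul,
      mul_comm, cf_x_pow_mul (by omega), if_pos le_rfl, Nat.sub_self, smul_eq_mul] at h3
    exact (mul_ne_zero (natCast_ne_zero (p := p) (by omega) (by omega)) hne) h3

theorem map_mem_sandwich (g : W k p ≃ₗ⁅k⁆ W k p) {c : W k p} (hc : c ∈ sandwich k p) :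
    g c ∈ sandwich k p := by
  intro w
  obtain ⟨v, rfl⟩ : ∃ v, g v = w := g.surjective w
  rw [← LieEquiv.map_lie, ← LieEquiv.map_lie, hc v]
  exact map_zero g.toLinearEquiv

/-- The characterization of `W_{≥ 0}` by a normalizer uses only the bracket, so it is preserved by
automorphisms. -/
theorem cf_zero_map_apply_x (hp : 3 < p) (g : W k p ≃ₗ⁅k⁆ W k p) {w : W k p}
    (hw : cf 0 (w (x k p)) = 0) : cf 0 (g w (x k p)) = 0 := by
  rw [cf_zero_apply_x_iff hp] at hw ⊢
  intro c hc
  have h1 := map_mem_sandwich g (hw _ (map_mem_sandwich g.symm hc))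
  rwa [LieEquiv.map_lie, LieEquiv.apply_symm_apply] at h1

theorem sum_W_apply {ι : Type*} (s : Finset ι) (D : ι → W k p) (a : TruncPoly k p) :
    (∑ i ∈ s, D i) a = ∑ i ∈ s, D i a :=
  map_sum (⟨⟨fun D : W k p => D a, rfl⟩, fun _ _ => rfl⟩ : W k p →+ TruncPoly k p) D s

/-- Every automorphism of `W` is conjugation by an automorphism of `A(1)`. -/
theorem exists_subst_of_lieEquiv (hp : 3 < p) (g : W k p ≃ₗ⁅k⁆ W k p) :
    ∃ (y : TruncPoly k p) (hy : cf 0 y = 0), cf 1 y ≠ 0 ∧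
      ∀ D : W k p, g D y = subst hy (D (x k p)) := by
  set D₀ := g (del k p) with hD₀
  set f := D₀ (x k p) with hf
  set E := g (x k p • del k p) with hE
  set h := E (x k p) with hh
  have hf0 : cf 0 f ≠ 0 := by
    intro h0
    have h1 := cf_zero_map_apply_x hp g.symm h0
    rw [hD₀, LieEquiv.symm_apply_apply, del_x, cf_zero_one] at h1
    exact one_ne_zero h1
  have hh0 : cf 0 h = 0 := by
    apply cf_zero_map_apply_x hp g
    rw [smul_del_apply_x, x_dvd_iff _ |>.mp (dvd_refl _)]
  obtain ⟨u, hu⟩ := (isUnit_of_cf_zero_ne hf0).exists_right_inv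
  -- If `g` is conjugation by `σ`, then `g (x ∂) = σ(x) g(∂)`; hence the only candidate for `σ(x)`
  -- is the quotient of the two values at `x`.
  obtain ⟨y, hy⟩ : ∃ y, y = h * u := ⟨_, rfl⟩
  have hfy : h = y * f := by rw [hy]; linear_combination -h * hu
  have hEy : ∀ a, E a = y * D₀ a := by
    intro a
    rw [W_apply E, W_apply D₀, ← hf, ← hh, hfy, mul_assoc]
  have br1 : ⁅del k p, x k p • del k p⁆ = del k p := by
    apply W_ext
    rw [bracket_apply_x, smul_del_apply_x, del_x]
    simp
  have hD₀y : D₀ y = 1 := by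
    have h1 := congrArg (fun D : W k p => D (x k p)) (congrArg g br1)
    simp only [LieEquiv.map_lie] at h1
    rw [bracket_apply_x, ← hE, ← hD₀, ← hh, ← hf, hfy, Derivation.leibniz] at h1
    rw [W_apply D₀, ← hf]
    simp only [smul_eq_mul] at h1
    linear_combination u * h1 + (1 - f * del k p y) * hu
  have hy0 : cf 0 y = 0 := by rw [hy, cf_zero_mul, hh0, zero_mul]
  have hdy : f * del k p y = 1 := by rw [← hD₀y, W_apply D₀]
  refine ⟨y, hy0, ?_, ?_⟩
  · intro h1
    have := congrArg (cf 0) hdy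
    rw [cf_zero_mul, cf_zero_del, h1, mul_zero, cf_zero_one] at this
    exact zero_ne_one this
  · have key : ∀ n < p, g (x k p ^ n • del k p) y = y ^ n := by
      intro n
      induction n with
      | zero => intro _; rw [pow_zero, pow_zero, one_smul, ← hD₀, hD₀y]
      | succ n ih =>
        intro hn
        have ih := ih (by omega)
        set F := g (x k p ^ n • del k p) with hF
        set H := g (x k p ^ (n + 1) • del k p) with hH
        have hn0 : ((n + 1 : ℕ) : k) ≠ 0 := natCast_ne_zero (p := p) (by omega) hn
        have b1 : ⁅del k p, x k p ^ (n + 1) • del k p⁆ =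
            ((n + 1 : ℕ) : k) • (x k p ^ n • del k p) := by
          apply W_ext
          rw [bracket_apply_x, smul_del_apply_x, del_x, del_x_pow, Derivation.map_one_eq_zero,
            Derivation.smul_apply, smul_del_apply_x, Nat.add_sub_cancel]
          ring
        have b2 : ⁅x k p • del k p, x k p ^ (n + 1) • del k p⁆ =
            (n : k) • (x k p ^ (n + 1) • del k p) := by
          apply W_ext
          rw [bracket_apply_x, smul_del_apply_x, smul_del_apply_x, del_x, del_x_pow,
            Derivation.smul_apply, smul_del_apply_x, Nat.add_sub_cancel, mul_smul_comm, ← pow_succ',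
            mul_one]
          push_cast
          module
        have c1 := congrArg (fun D : W k p => D y) (congrArg g b1)
        have c2 := congrArg (fun D : W k p => D y) (congrArg g b2)
        simp only [LieEquiv.map_lie, map_smul] at c1 c2
        rw [Derivation.commutator_apply, ← hD₀, hD₀y, Derivation.map_one_eq_zero, sub_zero,
          Derivation.smul_apply, ← hF, ih, ← hH] at c1
        rw [Derivation.commutator_apply, ← hE, ← hH, hEy, hEy, hD₀y, mul_one, c1,
          Derivation.smul_apply, mul_smul_comm, ← pow_succ', sub_eq_iff_eq_add] at c2
        -- The bracket with `∂` gives `D₀ (H y) = (n + 1) y ^ n`, and the bracket with `x ∂` gives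
        -- `y D₀ (H y) - H y = n H y`. Together they determine `H y`, as `n + 1` is invertible.
        have c3 : ((n + 1 : ℕ) : k) • y ^ (n + 1) = ((n + 1 : ℕ) : k) • H y := by
          rw [c2]
          push_cast
          module
        exact (smul_right_injective _ hn0 c3).symm
    intro D
    have hD : D = ∑ n ∈ Finset.range p, cf n (D (x k p)) • (x k p ^ n • del k p) := by
      apply W_ext
      conv_lhs => rw [eq_sum_smul (D (x k p))]
      rw [sum_W_apply]
      refine Finset.sum_congr rfl fun n _ => ?_
      rw [Derivation.smul_apply, smul_del_apply_x]
    have hgD : g D = ∑ n ∈ Finset.range p, cf n (D (x k p)) • g (x k p ^ n • del k p) := by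
      conv_lhs => rw [hD]
      change g.toLinearEquiv _ = _
      rw [map_sum]
      refine Finset.sum_congr rfl fun n _ => ?_
      rw [map_smul]
      rfl
    conv_rhs => rw [eq_sum_smul (D (x k p))]
    rw [hgD, map_sum, sum_W_apply]
    refine Finset.sum_congr rfl fun n hn => ?_
    rw [Derivation.smul_apply, key n (Finset.mem_range.mp hn), map_smul, map_pow, subst_x]

theorem cf_subst_of_dvd {y : TruncPoly k p} (hy : cf 0 y = 0) {n : ℕ} (hn : n < p)
    {a : TruncPoly k p} (h : x k p ^ n ∣ a) : cf n (subst hy a) = cf 1 y ^ n * cf n a := by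
  obtain ⟨u, rfl, hu⟩ := exists_eq_x_pow_mul hn h
  obtain ⟨v, hv⟩ := (x_dvd_iff y).mpr hy
  have h1 : cf 1 y = cf 0 v := by
    have := cf_x_pow_mul (Fact.out : p.Prime).one_lt 1 v
    rw [pow_one, ← hv] at this
    simpa using this
  rw [map_mul, map_pow, subst_x, h1, ← hu]
  have h2 : y ^ n = x k p ^ n * v ^ n := by rw [hv, mul_pow]
  rw [h2, mul_assoc, cf_x_pow_mul hn, if_pos le_rfl, Nat.sub_self, cf_zero_mul, cf_zero_pow,
    cf_zero_subst]

/-- A substitution with nonzero linear coefficient preserves orders, so it is injective; finite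
dimension does the rest. -/
theorem subst_bijective {y : TruncPoly k p} (hy : cf 0 y = 0) (h1 : cf 1 y ≠ 0) :
    Function.Bijective (subst hy) := by
  have hinj : Function.Injective (subst hy) := by
    rw [injective_iff_map_eq_zero]
    intro a ha
    by_contra hne
    obtain ⟨n, hn, hd, hc⟩ := exists_order hne
    have := cf_subst_of_dvd hy hn hd
    rw [ha, map_zero] at this
    exact mul_ne_zero (pow_ne_zero n h1) hc this.symm
  have : FiniteDimensional k (TruncPoly k p) := (truncBasis k p).finiteDimensional_of_finite
  exact ⟨hinj, (LinearMap.injective_iff_surjective (f := (subst hy).toLinearMap)).mp hinj⟩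

/-- The conjugate of a derivation by an automorphism of `A(1)`. -/
def conjDer (σ : TruncPoly k p ≃ₐ[k] TruncPoly k p) (D : W k p) : W k p :=
  Derivation.mk' (σ.toLinearMap ∘ₗ (D : TruncPoly k p →ₗ[k] TruncPoly k p) ∘ₗ
    σ.symm.toLinearMap) fun a b => by simp

theorem conjDer_apply (σ : TruncPoly k p ≃ₐ[k] TruncPoly k p) (D : W k p) (a : TruncPoly k p) :
    conjDer σ D a = σ (D (σ.symm a)) := rfl

/-- Conjugation by an automorphism of `A(1)`, as an automorphism of `W`. -/
def conjEquiv (σ : TruncPoly k p ≃ₐ[k] TruncPoly k p) : W k p ≃ₗ⁅k⁆ W k p where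
  toFun := conjDer σ
  map_add' D E := by apply W_ext; simp [conjDer_apply]
  map_smul' c D := by apply W_ext; simp [conjDer_apply]
  map_lie' {D E} := by
    apply W_ext
    simp only [Derivation.commutator_apply, conjDer_apply, AlgEquiv.symm_apply_apply, map_sub]
  invFun := conjDer σ.symm
  left_inv D := by
    apply W_ext
    simp [conjDer_apply]
  right_inv D := by
    apply W_ext
    simp [conjDer_apply]

theorem exists_lieEquiv_of_subst {y : TruncPoly k p} (hy : cf 0 y = 0) (h1 : cf 1 y ≠ 0) :
    ∃ g : W k p ≃ₗ⁅k⁆ W k p, ∀ D : W k p, g D y = subst hy (D (x k p)) := by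
  let σ := AlgEquiv.ofBijective (subst hy) (subst_bijective hy h1)
  refine ⟨conjEquiv σ, fun D => ?_⟩
  have hσ : σ (x k p) = y := subst_x hy
  have hσ' : σ.symm y = x k p := by rw [← hσ, AlgEquiv.symm_apply_apply]
  change conjDer σ D y = _
  rw [conjDer_apply, hσ']
  rfl

end Automorphisms

/-! ### Characters as quadratic differentials; action and height. -/

section Characters

variable {k : Type*} [Field k] {p : ℕ}

theorem mem_orbit_self (χ : Module.Dual k (W k p)) : χ ∈ orbit χ :=
  ⟨LieEquiv.refl, rfl⟩

theorem mem_orbit_symm {χ ψ : Module.Dual k (W k p)} (h : ψ ∈ orbit χ) : χ ∈ orbit ψ := by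
  obtain ⟨g, rfl⟩ := h
  refine ⟨g.symm, LinearMap.ext fun w => ?_⟩
  rw [act_apply, act_apply, LieEquiv.symm_symm, LieEquiv.symm_apply_apply]

theorem mem_orbit_trans {χ ψ ω : Module.Dual k (W k p)} (h : ψ ∈ orbit χ) (h' : ω ∈ orbit ψ) :
    ω ∈ orbit χ := by
  obtain ⟨g, rfl⟩ := h
  obtain ⟨g', rfl⟩ := h'
  exact ⟨g.trans g', LinearMap.ext fun w => rfl⟩

variable [Fact p.Prime] [CharP k p]

/-- The functional `f ∂ ↦ Res (x ^ (-p) q f dx)`. -/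
def chi (q : TruncPoly k p) : Module.Dual k (W k p) :=
  cf (p - 1) ∘ₗ LinearMap.mulLeft k q ∘ₗ (evalX k p).toLinearMap

theorem chi_apply (q : TruncPoly k p) (D : W k p) : chi q D = cf (p - 1) (q * D (x k p)) := rfl

theorem chi_basis (q : TruncPoly k p) (n : Fin p) : chi q (basis k p n) = cf (p - 1 - n) q := by
  have := prime_pos (p := p)
  rw [chi_apply, basis_apply, smul_del_apply_x, mul_comm, cf_x_pow_mul (by omega),
    if_pos (by omega)]

theorem chi_add (q r : TruncPoly k p) : chi (q + r) = chi q + chi r := by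
  ext D
  simp [chi_apply, add_mul]

theorem chi_smul (a : k) (q : TruncPoly k p) : chi (a • q) = a • chi q := by
  ext D
  simp [chi_apply]

theorem chi_injective : Function.Injective (chi : TruncPoly k p → Module.Dual k (W k p)) := by
  intro q r h
  refine cf_ext fun n hn => ?_
  have h1 := LinearMap.congr_fun h (basis k p ⟨p - 1 - n, by omega⟩)
  rwa [chi_basis, chi_basis, show p - 1 - (p - 1 - n) = n by omega] at h1

theorem chi_surjective : Function.Surjective (chi : TruncPoly k p → Module.Dual k (W k p)) := by
  intro χ
  refine ⟨∑ n ∈ Finset.range p, (if h : p - 1 - n < p then χ (basis k p ⟨p - 1 - n, h⟩) else 0) •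
    x k p ^ n, (basis k p).ext fun m => ?_⟩
  rw [chi_basis, cf_sum_smul (by omega), if_pos (by omega), dif_pos (by omega)]
  congr 3
  omega

theorem e'_eq_chi {j : ℤ} {m : ℕ} (h : j = (m : ℤ) - 1) (hm : m < p) :
    e' k p j = chi (x k p ^ (p - 1 - m)) := by
  refine (basis k p).ext fun n => ?_
  rw [chi_basis, cf_x_pow (by omega), e', dif_pos (by omega), Module.Basis.coord_apply,
    Module.Basis.repr_self, Finsupp.single_apply]
  refine if_congr ?_ rfl rfl
  rw [Fin.ext_iff]
  simp only
  omega

/-- The action of the substitution `x ↦ y` on the space of the `q` that represent the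
functionals `chi q`. -/
def twist {y : TruncPoly k p} (hy : cf 0 y = 0) (q : TruncPoly k p) : TruncPoly k p :=
  (cf 1 y ^ p)⁻¹ • (subst hy q * del k p y ^ 2)

/-- If `D` is the conjugate of `E`, then `D(x) y' = D y = E(x)(y)`. One factor `y'` of the twist
thus converts `D(x)` into the substituted `E(x)`, and the other is the one in the residue formula.
-/
theorem chi_twist_apply {y : TruncPoly k p} (hy : cf 0 y = 0) (h1 : cf 1 y ≠ 0)
    (q : TruncPoly k p) (D E : W k p) (h : D y = subst hy (E (x k p))) :
    chi (twist hy q) D = chi q E := by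
  have h2 := cf_last_subst_mul_del hy (q * E (x k p))
  rw [map_mul (subst hy), ← h, W_apply D] at h2
  rw [chi_apply, chi_apply, twist, smul_mul_assoc, map_smul, smul_eq_mul,
    inv_mul_eq_iff_eq_mul₀ (pow_ne_zero p h1), ← h2]
  congr 1
  ring

theorem mem_orbit_chi_iff (hp : 3 < p) (q : TruncPoly k p) (ψ : Module.Dual k (W k p)) :
    ψ ∈ orbit (chi q) ↔
      ∃ (y : TruncPoly k p) (hy : cf 0 y = 0), cf 1 y ≠ 0 ∧ ψ = chi (twist hy q) := by
  constructor
  · rintro ⟨g, rfl⟩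
    obtain ⟨y, hy, h1, hg⟩ := exists_subst_of_lieEquiv hp g
    refine ⟨y, hy, h1, LinearMap.ext fun D => ?_⟩
    rw [act_apply, chi_twist_apply hy h1 q D (g.symm D)]
    rw [← hg, LieEquiv.apply_symm_apply]
  · rintro ⟨y, hy, h1, rfl⟩
    obtain ⟨g, hg⟩ := exists_lieEquiv_of_subst hy h1
    refine ⟨g, LinearMap.ext fun D => ?_⟩
    rw [act_apply, chi_twist_apply hy h1 q D (g.symm D)]
    rw [← hg, LieEquiv.apply_symm_apply]

theorem x_pow_dvd_twist {y : TruncPoly k p} (hy : cf 0 y = 0) {n : ℕ} {q : TruncPoly k p}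
    (h : x k p ^ n ∣ q) : x k p ^ n ∣ twist hy q := by
  rw [twist, Algebra.smul_def]
  exact Dvd.dvd.mul_left (Dvd.dvd.mul_right (x_pow_dvd_subst hy h) _) _

theorem cf_twist_of_dvd {y : TruncPoly k p} (hy : cf 0 y = 0) {n : ℕ} (hn : n < p)
    {q : TruncPoly k p} (h : x k p ^ n ∣ q) :
    cf n (twist hy q) = (cf 1 y ^ p)⁻¹ * (cf 1 y ^ (n + 2) * cf n q) := by
  have h1 := cf_mul_of_dvd (n := 0) (by omega) (x_pow_dvd_subst hy h) (b := del k p y ^ 2)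
    (by simp)
  rw [add_zero] at h1
  rw [twist, map_smul, h1, cf_subst_of_dvd hy hn h, cf_zero_pow, cf_zero_del, smul_eq_mul]
  ring

theorem chi_vanishes_on_Wge_iff (q : TruncPoly k p) {i : ℤ} (h1 : -1 ≤ i) (h2 : i ≤ (p : ℤ) - 2) :
    (∀ w ∈ Wge k p i, chi q w = 0) ↔ x k p ^ ((p : ℤ) - 1 - i).toNat ∣ q := by
  rw [x_pow_dvd_iff (by omega)]
  constructor
  · intro h n hn
    have h3 := h (e k p ((p : ℤ) - 2 - n))
      (Submodule.subset_span ⟨_, by omega, by omega, by omega, rfl⟩)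
    rw [e, if_pos (by omega), chi_apply, smul_del_apply_x, mul_comm, cf_x_pow_mul (by omega),
      if_pos (by omega)] at h3
    rwa [show p - 1 - ((p : ℤ) - 2 - n + 1).toNat = n by omega] at h3
  · intro h w hw
    refine Submodule.span_induction (p := fun w _ => chi q w = 0) ?_ (map_zero _) ?_ ?_ hw
    · rintro _ ⟨j, hj1, hj2, hj3, rfl⟩
      rw [e, if_pos (by omega), chi_apply, smul_del_apply_x, mul_comm, cf_x_pow_mul (by omega),
        if_pos (by omega)]
      exact h _ (by omega)
    · intro a b _ _ ha hb
      rw [map_add, ha, hb, add_zero]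
    · intro c a _ ha
      rw [map_smul, ha, smul_zero]

/-- The value of `chi q` on `e_j` is the coefficient of `x ^ (p - 2 - j)` in `q`. The case `n = p`
is `q = 0`, of height `-1`. -/
theorem height_chi {q : TruncPoly k p} {n : ℕ} (hn : n ≤ p) (hd : x k p ^ n ∣ q)
    (hne : n < p → cf n q ≠ 0) : height (chi q) = (p : ℤ) - 1 - n := by
  have hp := (Fact.out : p.Prime).two_le
  have he : chi q (e k p ((p : ℤ) - 2)) = cf 0 q := by
    rw [e, if_pos (by omega), chi_apply, smul_del_apply_x, mul_comm, cf_x_pow_mul (by omega),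
      if_pos (by omega), show p - 1 - ((p : ℤ) - 2 + 1).toNat = 0 by omega]
  rw [height, he]
  rcases Nat.eq_zero_or_pos n with rfl | hpos
  · rw [if_neg (hne (by omega))]
    simp
  · have h0 : cf 0 q = 0 := (x_pow_dvd_iff hn q).mp hd 0 hpos
    rw [if_pos h0]
    refine IsLeast.csInf_eq ⟨⟨by omega, by omega, ?_⟩, ?_⟩
    · rw [chi_vanishes_on_Wge_iff q (by omega) (by omega)]
      rwa [show ((p : ℤ) - 1 - ((p : ℤ) - 1 - n)).toNat = n by omega]
    · rintro i ⟨h1, h2, h3⟩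
      rw [chi_vanishes_on_Wge_iff q h1 h2, x_pow_dvd_iff (by omega)] at h3
      by_contra! hlt
      exact hne (by omega) (h3 n (by omega))

theorem exists_order_le (q : TruncPoly k p) :
    ∃ n ≤ p, x k p ^ n ∣ q ∧ (n < p → cf n q ≠ 0) := by
  rcases eq_or_ne q 0 with rfl | h
  · exact ⟨p, le_rfl, dvd_zero _, fun h => absurd h (lt_irrefl p)⟩
  · obtain ⟨n, hn, hd, hne⟩ := exists_order h
    exact ⟨n, hn.le, hd, fun _ => hne⟩

theorem height_chi_eq_iff {q : TruncPoly k p} {n : ℕ} (hn : n < p) :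
    height (chi q) = (p : ℤ) - 1 - n ↔ x k p ^ n ∣ q ∧ cf n q ≠ 0 := by
  constructor
  · intro h
    obtain ⟨m, hm, hd, hne⟩ := exists_order_le q
    rw [height_chi hm hd hne] at h
    obtain rfl : m = n := by omega
    exact ⟨hd, hne hn⟩
  · rintro ⟨hd, hne⟩
    exact height_chi hn.le hd fun _ => hne

theorem height_eq_of_mem_orbit (hp : 3 < p) {χ ψ : Module.Dual k (W k p)} (h : ψ ∈ orbit χ) :
    height ψ = height χ := by
  obtain ⟨q, rfl⟩ := chi_surjective χ
  obtain ⟨y, hy, h1, rfl⟩ := (mem_orbit_chi_iff hp q ψ).mp h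
  obtain ⟨n, hn, hd, hne⟩ := exists_order_le q
  rw [height_chi hn hd hne, height_chi hn (x_pow_dvd_twist hy hd)]
  intro hlt
  rw [cf_twist_of_dvd hy hlt hd]
  have := hne hlt
  positivity

end Characters

/-! ### Normal forms and the residue of the square root. -/

section Classification

variable {k : Type*} [Field k] {p : ℕ} [Fact p.Prime] [CharP k p]

theorem one_add_mul_one_add {s : ℕ} (hs : 0 < s) (c d : TruncPoly k p) :
    ∃ z, (1 + x k p ^ s * c) * (1 + x k p ^ s * d) = 1 + x k p ^ s * z ∧
      cf 0 z = cf 0 c + cf 0 d := by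
  refine ⟨c + d + x k p ^ s * (c * d), by ring, ?_⟩
  rw [map_add, map_add, cf_x_pow_mul prime_pos, if_neg (by omega), add_zero]

theorem one_add_pow {s : ℕ} (hs : 0 < s) (c : TruncPoly k p) (n : ℕ) :
    ∃ z, (1 + x k p ^ s * c) ^ n = 1 + x k p ^ s * z ∧ cf 0 z = n * cf 0 c := by
  induction n with
  | zero => exact ⟨0, by simp, by simp⟩
  | succ n ih =>
    obtain ⟨z, h1, h2⟩ := ih
    obtain ⟨w, h3, h4⟩ := one_add_mul_one_add hs z c
    refine ⟨w, by rw [pow_succ, h1, h3], ?_⟩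
    rw [h4, h2]
    push_cast
    ring

theorem cf_one_add {s : ℕ} (hs : 0 < s) (hsp : s < p) (z : TruncPoly k p) :
    cf s (1 + x k p ^ s * z) = cf 0 z := by
  rw [map_add, cf_x_pow_mul hsp, if_pos le_rfl, Nat.sub_self, ← pow_zero (x k p), cf_x_pow hsp,
    if_neg (by omega), zero_add]

theorem cf_zero_one_add {s : ℕ} (hs : 0 < s) (z : TruncPoly k p) :
    cf 0 (1 + x k p ^ s * z) = 1 := by
  rw [map_add, cf_x_pow_mul prime_pos, if_neg (by omega), cf_zero_one, add_zero]

theorem cf_zero_x : cf 0 (x k p) = 0 := (x_dvd_iff _).mp (dvd_refl _)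

theorem cf_one_x : cf 1 (x k p) = 1 := by
  simpa using cf_x_pow (k := k) (Fact.out : p.Prime).one_lt 1

/-- The substitution `x ↦ x + t x ^ (s + 1)` changes the coefficients of degree up to `n + s`
of an element of order `n` only in degree `n + s`. -/
theorem twist_x_add {s n : ℕ} (hs : 0 < s) (t : k) (q : TruncPoly k p) (hn : n < p)
    (hq : x k p ^ n ∣ q) :
    ∃ (y : TruncPoly k p) (hy : cf 0 y = 0), cf 1 y = 1 ∧ ∃ z,
      twist hy q = q + x k p ^ (n + s) * z ∧
      cf 0 z = t * ((n + 2 * (s + 1) : ℕ) : k) * cf n q := by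
  have hp := (Fact.out : p.Prime).one_lt
  obtain ⟨u, rfl, hu⟩ := exists_eq_x_pow_mul hn hq
  obtain ⟨θ, hθ⟩ : ∃ θ, θ = 1 + x k p ^ s * algebraMap k _ t := ⟨_, rfl⟩
  obtain ⟨y, hyθ⟩ : ∃ y, y = x k p * θ := ⟨_, rfl⟩
  have ht0 : cf 0 (algebraMap k (TruncPoly k p) t) = t := by
    rw [Algebra.algebraMap_eq_smul_one, map_smul, cf_zero_one, smul_eq_mul, mul_one]
  have hy : cf 0 y = 0 := by rw [hyθ, cf_zero_mul, cf_zero_x, zero_mul]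
  have h1 : cf 1 y = 1 := by
    rw [hyθ]
    have := cf_x_pow_mul hp 1 θ
    rw [pow_one, if_pos le_rfl, Nat.sub_self] at this
    rw [this, hθ, cf_zero_one_add hs]
  have hdel : del k p y = 1 + x k p ^ s * (((s + 1 : ℕ) : k) • algebraMap k _ t) := by
    have : y = x k p + t • x k p ^ (s + 1) := by
      rw [hyθ, hθ, Algebra.smul_def]; ring
    rw [this, map_add, Derivation.map_smul, del_x, del_x_pow, Nat.add_sub_cancel, Algebra.smul_def,
      Algebra.smul_def, Algebra.smul_def]
    ring
  -- The unit part of `q` changes only beyond degree `s`. The first-order change comes from `y ^ n`,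
  -- which contributes `n t`, and from `(y')²`, which contributes `2 (s + 1) t`.
  obtain ⟨v, hv⟩ : x k p ^ (s + 1) ∣ subst hy u - u := by
    refine Dvd.dvd.trans ⟨algebraMap k _ t, ?_⟩ (sub_dvd_subst_sub hy u)
    rw [hyθ, hθ]
    ring
  obtain ⟨c, hc, hc0⟩ := one_add_pow hs (algebraMap k (TruncPoly k p) t) n
  obtain ⟨d, hd, hd0⟩ := one_add_pow hs (((s + 1 : ℕ) : k) • algebraMap k (TruncPoly k p) t) 2
  obtain ⟨z, hz, hz0⟩ := one_add_mul_one_add hs c d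
  refine ⟨y, hy, h1, z * u + x k p * (v + x k p ^ s * (z * v)), ?_, ?_⟩
  · have hsu : subst hy u = u + x k p ^ (s + 1) * v := by rw [← hv]; ring
    have hyn : y ^ n = x k p ^ n * (1 + x k p ^ s * c) := by rw [hyθ, mul_pow, hθ, hc]
    rw [twist, h1, one_pow, inv_one, one_smul, map_mul, map_pow, subst_x, hsu, hyn, hdel, hd]
    linear_combination x k p ^ n * (u + x k p ^ (s + 1) * v) * hz
  · rw [map_add, cf_zero_mul, cf_zero_mul, cf_zero_x, hz0, hc0, hd0, map_smul, ht0, hu]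
    push_cast
    simp only [smul_eq_mul]
    ring

theorem twist_add {y : TruncPoly k p} (hy : cf 0 y = 0) (q r : TruncPoly k p) :
    twist hy (q + r) = twist hy q + twist hy r := by
  rw [twist, twist, twist, map_add, add_mul, smul_add]

theorem twist_smul {y : TruncPoly k p} (hy : cf 0 y = 0) (a : k) (q : TruncPoly k p) :
    twist hy (a • q) = a • twist hy q := by
  rw [twist, twist, map_smul, smul_mul_assoc, smul_comm]

theorem cf_zero_smul_x (b : k) : cf 0 (b • x k p) = 0 := by rw [map_smul, cf_zero_x, smul_zero]

theorem cf_one_smul_x (b : k) : cf 1 (b • x k p) = b := by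
  rw [map_smul, cf_one_x, smul_eq_mul, mul_one]

theorem twist_scale (b : k) (n : ℕ) :
    twist (cf_zero_smul_x (p := p) b) (x k p ^ n) = ((b ^ p)⁻¹ * b ^ (n + 2)) • x k p ^ n := by
  have h : del k p (b • x k p) ^ 2 = b ^ 2 • 1 := by
    rw [Derivation.map_smul, del_x, _root_.smul_pow, one_pow]
  rw [twist, map_pow, subst_x, cf_one_smul_x, h, _root_.smul_pow, mul_smul_comm, mul_one, smul_smul,
    smul_smul]
  congr 1
  ring

/-- Here `n'` is the half of `n` modulo `p`. -/
theorem eq_of_natCast_eq_zero (hp : 3 < p) {n n' s : ℕ}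
    (hn' : 2 * n' = n ∨ 2 * n' = n + p) (hs : n + s < p)
    (h : ((n + 2 * (s + 1) : ℕ) : k) = 0) : s = p - 1 - n' := by
  rw [CharP.cast_eq_zero_iff k p] at h
  have h1 : p ∣ 2 * (n' + s + 1) := by
    rcases hn' with h2 | h2
    · rwa [show 2 * (n' + s + 1) = n + 2 * (s + 1) by omega]
    · rw [show 2 * (n' + s + 1) = n + 2 * (s + 1) + p by omega]
      exact dvd_add h dvd_rfl
  have h2 : p ∣ n' + s + 1 :=
    (Nat.Coprime.dvd_mul_left ((Nat.coprime_primes Fact.out Nat.prime_two).mpr (by omega))).mp h1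
  obtain ⟨c, hc⟩ := h2
  have h3 : c = 1 := by
    have h4 : 0 < c := Nat.pos_of_ne_zero (by rintro rfl; omega)
    have h5 : c < 2 := by
      by_contra! h6
      have := Nat.mul_le_mul_left p h6
      omega
    omega
  subst h3
  omega

/-- Every orbit contains an element of order `n` with at most two coefficients. -/
theorem exists_mem_orbit_normal_form (hp : 3 < p) {n n' : ℕ} (hn : n < p)
    (hn' : 2 * n' = n ∨ 2 * n' = n + p) {q : TruncPoly k p} (hd : x k p ^ n ∣ q)
    (hne : cf n q ≠ 0) :
    ∃ β : k, chi (cf n q • x k p ^ n + β • x k p ^ (n + (p - 1 - n'))) ∈ orbit (chi q) := by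
  have key : ∀ S : ℕ, n + S ≤ p → ∃ r, chi r ∈ orbit (chi q) ∧ x k p ^ n ∣ r ∧ cf n r = cf n q ∧
      ∀ s, 0 < s → s < S → s ≠ p - 1 - n' → cf (n + s) r = 0 := by
    intro S
    induction S with
    | zero => exact fun _ => ⟨q, mem_orbit_self _, hd, rfl, fun s _ h => by omega⟩
    | succ S ih =>
      intro hS
      obtain ⟨r, h1, h2, h3, h4⟩ := ih (by omega)
      by_cases hc : S = 0 ∨ S = p - 1 - n'
      · refine ⟨r, h1, h2, h3, fun s hs hs' hs'' => h4 s hs ?_ hs''⟩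
        omega
      · push Not at hc
        set A : k := ((n + 2 * (S + 1) : ℕ) : k) with hA
        have hA0 : A ≠ 0 := fun h => hc.2 (eq_of_natCast_eq_zero hp hn' (by omega) h)
        -- The parameter is chosen so that the change `t A (cf n r)` cancels the coefficient in
        -- degree `n + S`.
        obtain ⟨y, hy, hy1, z, hz, hz0⟩ := twist_x_add (s := S) (by omega)
          (-(cf (n + S) r) / (A * cf n r)) r hn h2
        refine ⟨twist hy r, mem_orbit_trans h1 ((mem_orbit_chi_iff hp _ _).mpr
          ⟨y, hy, by rw [hy1]; exact one_ne_zero, rfl⟩), x_pow_dvd_twist hy h2, ?_, ?_⟩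
        · rw [hz, map_add, cf_x_pow_mul hn, if_neg (by omega), add_zero, h3]
        · intro s hs hs' hs''
          rw [hz, map_add, cf_x_pow_mul (by omega)]
          rcases Nat.lt_or_ge s S with hlt | hge
          · rw [if_neg (by omega), add_zero, h4 s hs hlt hs'']
          · obtain rfl : s = S := by omega
            rw [if_pos le_rfl, Nat.sub_self, hz0, ← hA]
            have : cf n r ≠ 0 := by rwa [h3]
            field_simp
            ring
  obtain ⟨r, h1, h2, h3, h4⟩ := key (p - n) (by omega)
  set s₀ := p - 1 - n' with hs₀
  -- For `s₀ = 0`, that is `n = p - 2`, both monomials coincide and the leading coefficient must not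
  -- be counted twice.
  obtain ⟨β, hβ, hβ'⟩ : ∃ β : k, (s₀ = 0 → β = 0) ∧ (s₀ ≠ 0 → β = cf (n + s₀) r) :=
    ⟨if s₀ = 0 then 0 else cf (n + s₀) r, fun h => if_pos h, fun h => if_neg h⟩
  refine ⟨β, ?_⟩
  convert h1 using 2
  refine cf_ext fun m hm => ?_
  rw [map_add, map_smul, map_smul, cf_x_pow hm, cf_x_pow hm]
  rcases Nat.lt_trichotomy m n with hlt | rfl | hgt
  · rw [if_neg (by omega), if_neg (by omega), (x_pow_dvd_iff hn.le r).mp h2 m hlt]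
    simp
  · rw [if_pos rfl, h3]
    by_cases h0 : s₀ = 0
    · simp [hβ h0]
    · rw [if_neg (show ¬ m = m + s₀ by omega)]
      simp
  · rw [if_neg (by omega)]
    by_cases h0 : m = n + s₀
    · rw [if_pos h0, hβ' (by omega), h0]
      simp
    · have := h4 (m - n) (by omega) (by omega) (by omega)
      rw [show n + (m - n) = m by omega] at this
      rw [if_neg h0, this]
      simp

/-- Since `w ^ p = 1`, the power `(p + 1) / 2` is an explicit polynomial square root. -/
theorem exists_sq_eq {w : TruncPoly k p} (hp : 3 < p) (hw : cf 0 w = 1) :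
    (w ^ ((p + 1) / 2)) ^ 2 = w := by
  have hodd := (Fact.out : p.Prime).eq_two_or_odd
  rw [← pow_mul, show (p + 1) / 2 * 2 = p + 1 by omega, pow_succ, pow_self_eq_one hw, one_mul]

theorem cf_smul_sq {n : ℕ} (hn : n < p) {α : k} {r : TruncPoly k p} (hr : cf 0 r = 1) :
    cf n (α • (x k p ^ n * r ^ 2)) = α := by
  rw [map_smul, cf_x_pow_mul hn, if_pos le_rfl, Nat.sub_self, cf_zero_pow, hr, one_pow,
    smul_eq_mul, mul_one]

theorem x_pow_dvd_smul_sq {n : ℕ} {α : k} {r : TruncPoly k p} :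
    x k p ^ n ∣ α • (x k p ^ n * r ^ 2) := by
  rw [Algebra.smul_def]
  exact Dvd.dvd.mul_left (Dvd.intro _ rfl) _

theorem cf_eq_of_x_pow_mul_eq {n s : ℕ} (hs : n + s < p) {r r' : TruncPoly k p}
    (h : x k p ^ n * r = x k p ^ n * r') : cf s r = cf s r' := by
  have h1 := congrArg (cf (n + s)) h
  rwa [cf_x_pow_mul hs, cf_x_pow_mul hs, if_pos (by omega), if_pos (by omega),
    Nat.add_sub_cancel_left] at h1

/-- From `x ^ n (r - r') (r + r') = 0` the factor `r + r'`, a unit with constant term `2`, can be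
cancelled. Truncation leaves only the coefficients of `r` below degree `p - n` determined. -/
theorem smul_sq_unique (hp : 3 < p) {n : ℕ} (hn : n < p) {α α' : k} (hα : α ≠ 0)
    {r r' : TruncPoly k p} (hr : cf 0 r = 1) (hr' : cf 0 r' = 1)
    (h : α • (x k p ^ n * r ^ 2) = α' • (x k p ^ n * r' ^ 2)) :
    α = α' ∧ ∀ s, n + s < p → cf s r = cf s r' := by
  have h1 : α = α' := by rw [← cf_smul_sq hn (α := α) hr, h, cf_smul_sq hn hr']
  refine ⟨h1, fun s hs => cf_eq_of_x_pow_mul_eq hs ?_⟩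
  rw [← h1] at h
  have h2 := smul_right_injective _ hα h
  have h3 : cf 0 (r + r') ≠ 0 := by
    rw [map_add, hr, hr', one_add_one_eq_two]
    exact_mod_cast natCast_ne_zero (k := k) (p := p) (n := 2) (by omega) (by omega)
  obtain ⟨u, hu⟩ := (isUnit_of_cf_zero_ne h3).exists_right_inv
  linear_combination u * h2 - x k p ^ n * (r - r') * hu

/-- The effect of a substitution on the leading coefficient and on the residue of the square
root of a quadratic differential. -/
theorem twist_smul_sq {n n' : ℕ} (hn : n < p) (hn' : 2 * n' = n ∨ 2 * n' = n + p)
    {y : TruncPoly k p} (hy : cf 0 y = 0) (hb : cf 1 y ≠ 0) (α : k) {r : TruncPoly k p}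
    (hr : cf 0 r = 1) :
    ∃ (α' : k) (r' : TruncPoly k p), twist hy (α • (x k p ^ n * r ^ 2)) =
        α' • (x k p ^ n * r' ^ 2) ∧ cf 0 r' = 1 ∧
      α' * cf 1 y ^ (p - 1 - n) = cf 1 y * α ∧
      cf (p - 1 - n') r' = cf 1 y ^ (p - 1 - n') * cf (p - 1 - n') r := by
  obtain ⟨θ, hθ, hyθ⟩ := exists_eq_x_mul hy hb
  set b := cf 1 y with hbdef
  set d := b⁻¹ • del k p y with hd
  have hdel : del k p y = b • d := by rw [hd, smul_smul, mul_inv_cancel₀ hb, one_smul]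
  have hd0 : cf 0 d = 1 := by
    rw [hd, map_smul, cf_zero_del, smul_eq_mul, ← hbdef, inv_mul_cancel₀ hb]
  have hθn : θ ^ n = θ ^ n' * θ ^ n' := by
    rw [← pow_add, ← two_mul]
    rcases hn' with h | h
    · rw [h]
    · rw [h, pow_add, pow_self_eq_one hθ, mul_one]
  have hyn : ∀ m, y ^ m = b ^ m • (x k p ^ m * θ ^ m) := fun m => by
    rw [hyθ, _root_.smul_pow, mul_pow]
  -- With `y = b x θ` and `y' = b d`, this is the pullback of `x ^ n' r dx`, up to powers of `b`; `θ
  -- ^ p = 1` allows `θ ^ n` to be read as the square of `θ ^ n'` even when `n` is odd.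
  refine ⟨(b ^ p)⁻¹ * b ^ (n + 2) * α, θ ^ n' * subst hy r * d, ?_, ?_, ?_, ?_⟩
  · rw [twist, map_smul, map_mul, map_pow, map_pow, subst_x, hdel, hyn, hθn, ← hbdef]
    simp only [Algebra.smul_def, map_mul, map_pow]
    ring
  · rw [cf_zero_mul, cf_zero_mul, cf_zero_pow, hθ, cf_zero_subst, hr, hd0]
    simp
  · have hpe : b ^ p = b ^ (n + 1) * b ^ (p - 1 - n) := by
      rw [← pow_add]; congr 1; omega
    rw [hpe]
    field_simp
    ring
  -- The coefficient of `x ^ (p - 1 - n')` in `r` is the coefficient of `x ^ (p - 1)` in `x ^ n' r`,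
  -- so the residue formula applies.
  · have h1 := cf_last_subst_mul_del hy (x k p ^ n' * r)
    have h2 : subst hy (x k p ^ n' * r) * del k p y =
        b ^ (n' + 1) • (x k p ^ n' * (θ ^ n' * subst hy r * d)) := by
      rw [map_mul, map_pow, subst_x, hyn, hdel]
      simp only [Algebra.smul_def, map_pow]
      ring
    rw [h2, map_smul, cf_x_pow_mul (by omega), cf_x_pow_mul (by omega), if_pos (by omega),
      if_pos (by omega), smul_eq_mul, ← hbdef, show b ^ p = b ^ (n' + 1) * b ^ (p - 1 - n') by
        rw [← pow_add]; congr 1; omega, mul_assoc (b ^ (n' + 1))] at h1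
    exact mul_left_cancel₀ (pow_ne_zero _ hb) h1

end Classification

/-! ### Explicit description of the orbits. -/

section Orbits

variable {k : Type*} [Field k] {p : ℕ} [Fact p.Prime] [CharP k p]

theorem two_mul_natCast_half (hp : 3 < p) : (2 : k) * (((p + 1) / 2 : ℕ) : k) = 1 := by
  have hodd := (Fact.out : p.Prime).eq_two_or_odd
  have h : ((2 * ((p + 1) / 2) : ℕ) : k) = ((p + 1 : ℕ) : k) := by
    congr 1
    omega
  push_cast at h
  rw [h, CharP.cast_eq_zero, zero_add]

theorem two_ne_zero_of_char (hp : 3 < p) : (2 : k) ≠ 0 := by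
  exact_mod_cast natCast_ne_zero (k := k) (p := p) (n := 2) (by omega) (by omega)

/-- This supplies the scaling that normalizes a leading coefficient at height `i`. At `i = 1`
scaling has no effect on it. -/
theorem exists_mul_pow_eq [IsAlgClosed k] {i : ℕ} (hi : i ≠ 1) {c : k} (hc : c ≠ 0) :
    ∃ b, b ≠ 0 ∧ c * b ^ i = b := by
  rcases Nat.eq_zero_or_pos i with rfl | hpos
  · exact ⟨c, hc, by simp⟩
  · obtain ⟨b, hb⟩ := IsAlgClosed.exists_pow_nat_eq c⁻¹ (n := i - 1) (by omega)
    have hb0 : b ≠ 0 := by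
      rintro rfl
      rw [zero_pow (by omega)] at hb
      exact inv_ne_zero hc hb.symm
    refine ⟨b, hb0, ?_⟩
    rw [show i = i - 1 + 1 by omega, pow_succ, hb, ← mul_assoc, mul_inv_cancel₀ hc, one_mul]

/-- The element of order `n` with two coefficients, the first being `1`. -/
def std (k : Type*) [Field k] (p n s : ℕ) (a : k) : TruncPoly k p :=
  x k p ^ n + a • x k p ^ (n + s)

theorem std_eq_mul (n s : ℕ) (a : k) :
    std k p n s a = x k p ^ n * (1 + x k p ^ s * algebraMap k _ a) := by
  rw [std, Algebra.smul_def]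
  ring

theorem std_eq_smul_sq (hp : 3 < p) {s : ℕ} (n : ℕ) (hs : 0 < s) (hsp : s < p) (a : k) :
    ∃ r : TruncPoly k p, cf 0 r = 1 ∧ cf s r = 2⁻¹ * a ∧
      std k p n s a = (1 : k) • (x k p ^ n * r ^ 2) := by
  obtain ⟨z, hz, hz0⟩ := one_add_pow hs (algebraMap k (TruncPoly k p) a) ((p + 1) / 2)
  refine ⟨(1 + x k p ^ s * algebraMap k _ a) ^ ((p + 1) / 2), ?_, ?_, ?_⟩
  · rw [hz, cf_zero_one_add hs]
  · rw [hz, cf_one_add hs hsp, hz0, Algebra.algebraMap_eq_smul_one, map_smul, cf_zero_one,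
      smul_eq_mul, mul_one, inv_eq_of_mul_eq_one_right (two_mul_natCast_half hp)]
  · rw [exists_sq_eq hp (cf_zero_one_add hs _), one_smul, std_eq_mul]

/-- The substitution `x ↦ c x` multiplies `x ^ m` by `c ^ (m + 2 - p)`; the hypothesis on `c` says
exactly that the leading coefficient becomes `1`. -/
theorem mem_orbit_scale (hp : 3 < p) {n s : ℕ} (hn : n < p) {α β c : k} (hc : c ≠ 0)
    (h : c ^ (p - 1 - n) = c * α) :
    chi (std k p n s (β * c ^ s * α⁻¹)) ∈ orbit (chi (α • x k p ^ n + β • x k p ^ (n + s))) := by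
  have hα : α ≠ 0 := by
    rintro rfl
    rw [mul_zero] at h
    exact pow_ne_zero _ hc h
  rw [mem_orbit_chi_iff hp]
  refine ⟨c • x k p, cf_zero_smul_x c, by rwa [cf_one_smul_x], ?_⟩
  have h1 : (c ^ p)⁻¹ * c ^ (n + 2) = α⁻¹ := by
    rw [show p = n + 1 + (p - 1 - n) by omega, pow_add, h]
    field_simp
    rw [← pow_succ]
  have h2 : (c ^ p)⁻¹ * c ^ (n + s + 2) = c ^ s * α⁻¹ := by rw [← h1]; ring
  rw [twist_add, twist_smul, twist_smul, twist_scale, twist_scale, h1, h2, smul_smul, smul_smul,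
    mul_inv_cancel₀ hα, one_smul, std, mul_assoc]

theorem mem_orbit_std_imp (hp : 3 < p) {n n' : ℕ} (hn : n < p)
    (hn' : 2 * n' = n ∨ 2 * n' = n + p) (hs : 0 < p - 1 - n') {a : k} {q : TruncPoly k p}
    (h : chi q ∈ orbit (chi (std k p n (p - 1 - n') a))) :
    ∃ (α b : k) (r : TruncPoly k p), α ≠ 0 ∧ b ≠ 0 ∧ α * b ^ (p - 1 - n) = b ∧ cf 0 r = 1 ∧
      cf (p - 1 - n') r = b ^ (p - 1 - n') * (2⁻¹ * a) ∧ q = α • (x k p ^ n * r ^ 2) := by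
  obtain ⟨r₀, h1, h2, h3⟩ := std_eq_smul_sq hp n hs (by omega) a
  obtain ⟨y, hy, hb, h4⟩ := (mem_orbit_chi_iff hp _ _).mp h
  obtain ⟨α', r', h5, h6, h7, h8⟩ := twist_smul_sq hn hn' hy hb 1 h1
  rw [mul_one] at h7
  refine ⟨α', cf 1 y, r', ?_, hb, h7, h6, ?_, ?_⟩
  · rintro rfl
    rw [zero_mul] at h7
    exact hb h7.symm
  · rw [h8, h2]
  · rw [chi_injective h4, h3, h5]

variable [IsAlgClosed k]

theorem exists_std_mem_orbit (hp : 3 < p) {n n' : ℕ} (hn : n < p) (hn2 : n + 2 ≠ p)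
    (hn' : 2 * n' = n ∨ 2 * n' = n + p) {q : TruncPoly k p} (hd : x k p ^ n ∣ q)
    (hne : cf n q ≠ 0) : ∃ a, chi (std k p n (p - 1 - n') a) ∈ orbit (chi q) := by
  obtain ⟨β, hβ⟩ := exists_mem_orbit_normal_form hp hn hn' hd hne
  obtain ⟨c, hc, hc'⟩ := exists_mul_pow_eq (i := p - 1 - n) (by omega) (inv_ne_zero hne)
  rw [inv_mul_eq_iff_eq_mul₀ hne, mul_comm] at hc'
  exact ⟨_, mem_orbit_trans hβ (mem_orbit_scale hp hn hc hc')⟩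

/-- The orbits of height different from `-1` and `1`. -/
theorem mem_orbit_std_iff (hp : 3 < p) {n n' : ℕ} (hn : n < p) (hn2 : n + 2 ≠ p)
    (hn' : 2 * n' = n ∨ 2 * n' = n + p) (hs : 0 < p - 1 - n') {a : k} {q : TruncPoly k p} :
    chi q ∈ orbit (chi (std k p n (p - 1 - n') a)) ↔
    ∃ (α b : k) (r : TruncPoly k p), α ≠ 0 ∧ b ≠ 0 ∧ α * b ^ (p - 1 - n) = b ∧ cf 0 r = 1 ∧
      (n + (p - 1 - n') < p → cf (p - 1 - n') r = b ^ (p - 1 - n') * (2⁻¹ * a)) ∧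
      q = α • (x k p ^ n * r ^ 2) := by
  set s := p - 1 - n' with hs'
  constructor
  · intro h
    obtain ⟨α, b, r, h1, h2, h3, h4, h5, h6⟩ := mem_orbit_std_imp hp hn hn' hs h
    exact ⟨α, b, r, h1, h2, h3, h4, fun _ => h5, h6⟩
  · rintro ⟨α, b, r, h1, h2, h3, h4, h5, h6⟩
    have hd : x k p ^ n ∣ q := h6 ▸ x_pow_dvd_smul_sq
    have hq : cf n q = α := by rw [h6, cf_smul_sq hn h4]
    -- The normal form of `q` has some second coefficient `a₁`. Comparing residues relates it to
    -- `a`, and the scaling by `b / b₁` then carries one normal form to the other.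
    obtain ⟨a₁, ha₁⟩ := exists_std_mem_orbit hp hn hn2 hn' hd (by rwa [hq])
    have hmem := mem_orbit_symm ha₁
    obtain ⟨α₁, b₁, r₁, g1, g2, g3, g4, g5, g6⟩ := mem_orbit_std_imp hp hn hn' hs hmem
    rw [← hs'] at g5
    obtain ⟨rfl, hr⟩ := smul_sq_unique hp hn h1 h4 g4 (h6.symm.trans g6)
    refine mem_orbit_trans ?_ hmem
    rcases Nat.lt_or_ge (n + s) p with hlt | hge
    · have h7 := h5 hlt
      rw [hr s hlt, g5] at h7
      have h8 : b₁ ^ s * a₁ = b ^ s * a := by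
        have := two_ne_zero_of_char (k := k) hp
        field_simp at h7
        exact h7
      have h9 := mem_orbit_scale (s := s) hp hn (α := 1) (β := a) (c := b / b₁)
        (div_ne_zero h2 g2) (by
          rw [div_pow, mul_one, div_eq_div_iff (pow_ne_zero _ g2) g2]
          apply mul_left_cancel₀ h1
          linear_combination b₁ * h3 - b * g3)
      have h10 : a * (b / b₁) ^ s * 1⁻¹ = a₁ := by
        rw [div_pow, inv_one, mul_one, mul_div_assoc', div_eq_iff (pow_ne_zero _ g2)]
        linear_combination -h8
      rw [h10, one_smul] at h9
      exact h9
    · rw [std, std, x_pow_eq_zero hge, smul_zero, smul_zero]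
      exact mem_orbit_self _

/-- The orbits of height `1`. -/
theorem mem_orbit_smul_iff (hp : 3 < p) {α : k} (hα : α ≠ 0) {q : TruncPoly k p} :
    chi q ∈ orbit (chi (α • x k p ^ (p - 2))) ↔ x k p ^ (p - 2) ∣ q ∧ cf (p - 2) q = α := by
  have hlead : ∀ q r : TruncPoly k p, x k p ^ (p - 2) ∣ q → chi r ∈ orbit (chi q) →
      x k p ^ (p - 2) ∣ r ∧ cf (p - 2) r = cf (p - 2) q := by
    intro q r hd h
    obtain ⟨y, hy, hb, h1⟩ := (mem_orbit_chi_iff hp _ _).mp h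
    rw [chi_injective h1]
    refine ⟨x_pow_dvd_twist hy hd, ?_⟩
    rw [cf_twist_of_dvd hy (by omega) hd, show p - 2 + 2 = p by omega,
      inv_mul_cancel_left₀ (pow_ne_zero p hb)]
  have hα' : cf (p - 2) (α • x k p ^ (p - 2)) = α := by
    rw [map_smul, cf_x_pow (by omega), if_pos rfl, smul_eq_mul, mul_one]
  constructor
  · intro h
    have h1 := hlead _ _ (by rw [Algebra.smul_def]; exact Dvd.intro_left _ rfl) h
    rwa [hα'] at h1
  · rintro ⟨hd, rfl⟩
    -- Here the exceptional degree is `s = 0`, so the term of degree `p - 1` can be removed and only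
    -- the invariant leading coefficient is left.
    obtain ⟨β, hβ⟩ := exists_mem_orbit_normal_form hp (n := p - 2) (n' := p - 1) (by omega)
      (by omega) hd hα
    rw [Nat.sub_self, add_zero, ← add_smul] at hβ
    have h1 := (hlead _ _ hd hβ).2
    rw [map_smul, cf_x_pow (by omega), if_pos rfl, smul_eq_mul, mul_one] at h1
    rw [h1] at hβ
    exact mem_orbit_symm hβ

end Orbits

/-! ### Rational maps and Krull dimension in affine space. -/

section ZariskiTopology

variable {k : Type*} [Field k] {ι κ : Type*}

variable (k ι) in
/-- The affine space `k ^ ι` with the Zariski topology. -/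
abbrev Aff : Type _ := ι → k

instance : TopologicalSpace (Aff k ι) := zariski k ι

theorem isClosed_aff_iff {Z : Set (Aff k ι)} :
    IsClosed Z ↔ ∃ S : Set (MvPolynomial ι k), Z = zeros k S := by
  rw [← isOpen_compl_iff]
  change Zᶜᶜ ∈ {Z | ∃ S : Set (MvPolynomial ι k), Z = zeros k S} ↔ _
  rw [compl_compl]
  rfl

/-- A function that is, on the set `S`, the quotient of two polynomials, the denominator having
no zero on `S`. -/
def IsRational (S : Set (Aff k ι)) (g : Aff k ι → k) : Prop :=
  ∃ P Q : MvPolynomial ι k, ∀ v ∈ S, MvPolynomial.eval v Q ≠ 0 ∧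
    g v * MvPolynomial.eval v Q = MvPolynomial.eval v P

namespace IsRational

variable {S : Set (Aff k ι)} {g h : Aff k ι → k}

theorem const (c : k) : IsRational S fun _ => c :=
  ⟨MvPolynomial.C c, 1, fun v _ => by simp⟩

theorem coord (j : ι) : IsRational S fun v => v j :=
  ⟨MvPolynomial.X j, 1, fun v _ => by simp⟩

theorem add (hg : IsRational S g) (hh : IsRational S h) : IsRational S fun v => g v + h v := by
  obtain ⟨P, Q, hPQ⟩ := hg
  obtain ⟨R, T, hRT⟩ := hh
  refine ⟨P * T + R * Q, Q * T, fun v hv => ?_⟩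
  obtain ⟨h1, h2⟩ := hPQ v hv
  obtain ⟨h3, h4⟩ := hRT v hv
  rw [map_mul, map_add, map_mul, map_mul]
  exact ⟨mul_ne_zero h1 h3, by rw [← h2, ← h4]; ring⟩

theorem mul (hg : IsRational S g) (hh : IsRational S h) : IsRational S fun v => g v * h v := by
  obtain ⟨P, Q, hPQ⟩ := hg
  obtain ⟨R, T, hRT⟩ := hh
  refine ⟨P * R, Q * T, fun v hv => ?_⟩
  obtain ⟨h1, h2⟩ := hPQ v hv
  obtain ⟨h3, h4⟩ := hRT v hv
  rw [map_mul, map_mul]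
  exact ⟨mul_ne_zero h1 h3, by rw [← h2, ← h4]; ring⟩

theorem inv (hg : IsRational S g) (h0 : ∀ v ∈ S, g v ≠ 0) : IsRational S fun v => (g v)⁻¹ := by
  obtain ⟨P, Q, hPQ⟩ := hg
  refine ⟨Q, P, fun v hv => ?_⟩
  obtain ⟨h1, h2⟩ := hPQ v hv
  rw [← h2]
  exact ⟨mul_ne_zero (h0 v hv) h1, inv_mul_cancel_left₀ (h0 v hv) _⟩

theorem pow (hg : IsRational S g) (n : ℕ) : IsRational S fun v => g v ^ n := by
  induction n with
  | zero => simpa using const 1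
  | succ n ih => simpa only [pow_succ] using ih.mul hg

theorem zpow (hg : IsRational S g) (h0 : ∀ v ∈ S, g v ≠ 0) (n : ℤ) :
    IsRational S fun v => g v ^ n := by
  obtain ⟨n, rfl | rfl⟩ := n.eq_nat_or_neg
  · simpa only [zpow_natCast] using hg.pow n
  · simpa only [zpow_neg, zpow_natCast] using (hg.pow n).inv fun v hv => pow_ne_zero n (h0 v hv)

theorem sum {α : Type*} (s : Finset α) {g : α → Aff k ι → k} (hg : ∀ a ∈ s, IsRational S (g a)) :
    IsRational S fun v => ∑ a ∈ s, g a v := by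
  classical
  induction s using Finset.induction_on with
  | empty => simpa using const 0
  | insert a s ha ih =>
    simp only [Finset.sum_insert ha]
    exact (hg a (Finset.mem_insert_self a s)).add
      (ih fun b hb => hg b (Finset.mem_insert_of_mem hb))

theorem eval {F : Aff k ι → Aff k κ} (hF : ∀ j, IsRational S fun v => F v j)
    (f : MvPolynomial κ k) : IsRational S fun v => MvPolynomial.eval (F v) f := by
  induction f using MvPolynomial.induction_on with
  | C a => simpa using const a
  | add f g hf hg => simpa using hf.add hg
  | mul_X f j hf => simpa using hf.mul (hF j)

theorem continuousOn {F : Aff k ι → Aff k κ} (hF : ∀ j, IsRational S fun v => F v j) :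
    ContinuousOn F S := by
  rw [continuousOn_iff_isClosed]
  intro Z hZ
  obtain ⟨T, rfl⟩ := isClosed_aff_iff.mp hZ
  choose P Q hPQ using eval hF
  refine ⟨zeros k (P '' T), isClosed_aff_iff.mpr ⟨_, rfl⟩, ?_⟩
  ext v
  refine and_congr_left fun hv => ?_
  simp only [zeros, Set.mem_preimage, Set.mem_ofPred_eq, Set.forall_mem_image]
  refine forall₂_congr fun f _ => ?_
  obtain ⟨h1, h2⟩ := hPQ f v hv
  rw [← h2, mul_eq_zero, or_iff_left h1]

end IsRational

/-- The ideal of a closed irreducible subset is prime. -/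
theorem vanishingIdeal_isPrime {Z : Set (Aff k ι)} (hZ : IsIrreducible Z) :
    (MvPolynomial.vanishingIdeal k (Z : Set (ι → k))).IsPrime := by
  rw [Ideal.isPrime_iff]
  constructor
  · rw [Ideal.ne_top_iff_one]
    intro h
    obtain ⟨v, hv⟩ := hZ.nonempty
    have := MvPolynomial.mem_vanishingIdeal_iff.mp h v hv
    simp at this
  · intro f g hfg
    have hcl : ∀ f : MvPolynomial ι k, IsClosed (zeros k {f} : Set (Aff k ι)) :=
      fun f => isClosed_aff_iff.mpr ⟨_, rfl⟩
    have hsub : Z ⊆ (zeros k {f} : Set (Aff k ι)) ∪ (zeros k {g} : Set (Aff k ι)) := by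
      intro v hv
      have := MvPolynomial.mem_vanishingIdeal_iff.mp hfg v hv
      rw [map_mul, mul_eq_zero] at this
      simpa [zeros, MvPolynomial.aeval_eq_eval] using this
    rcases isPreirreducible_iff_isClosed_union_isClosed.mp hZ.isPreirreducible _ _ (hcl f) (hcl g)
      hsub with h | h
    · left
      rw [MvPolynomial.mem_vanishingIdeal_iff]
      intro v hv
      simpa [zeros, MvPolynomial.aeval_eq_eval] using h hv
    · right
      rw [MvPolynomial.mem_vanishingIdeal_iff]
      intro v hv
      simpa [zeros, MvPolynomial.aeval_eq_eval] using h hv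

theorem subset_of_vanishingIdeal_le {Y Z : Set (Aff k ι)} (hZ : IsClosed Z)
    (h : MvPolynomial.vanishingIdeal k (Z : Set (ι → k)) ≤
      MvPolynomial.vanishingIdeal k (Y : Set (ι → k))) : Y ⊆ Z := by
  obtain ⟨S, rfl⟩ := isClosed_aff_iff.mp hZ
  intro v hv f hf
  have h1 : f ∈ MvPolynomial.vanishingIdeal k (zeros k S) := by
    rw [MvPolynomial.mem_vanishingIdeal_iff]
    intro w hw
    rw [MvPolynomial.aeval_eq_eval]
    exact hw f hf
  have h2 := MvPolynomial.mem_vanishingIdeal_iff.mp (h h1) v hv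
  rwa [MvPolynomial.aeval_eq_eval] at h2

/-- Vanishing ideals turn chains of irreducible closed sets into chains of primes, and the
polynomial ring has Krull dimension the number of variables. -/
theorem topologicalKrullDim_aff_le [Finite ι] :
    topologicalKrullDim (Aff k ι) ≤ (Nat.card ι : WithBot ℕ∞) := by
  have h1 : topologicalKrullDim (Aff k ι) ≤
      Order.krullDim (PrimeSpectrum (MvPolynomial ι k))ᵒᵈ := by
    refine Order.krullDim_le_of_strictMono (fun Z : TopologicalSpace.IrreducibleCloseds (Aff k ι) =>
      OrderDual.toDual (⟨_, vanishingIdeal_isPrime Z.isIrreducible⟩ : PrimeSpectrum _)) ?_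
    intro Y Z hYZ
    rw [OrderDual.toDual_lt_toDual, lt_iff_le_not_ge]
    constructor
    · exact MvPolynomial.vanishingIdeal_anti_mono hYZ.le
    · intro h
      exact hYZ.not_ge (subset_of_vanishingIdeal_le Y.isClosed h)
  rw [Order.krullDim_orderDual] at h1
  refine h1.trans_eq ?_
  have h2 := MvPolynomial.ringKrullDim_of_isNoetherianRing (R := k) (ι := ι)
  rw [ringKrullDim_eq_zero_of_field, zero_add] at h2
  exact h2

variable [Infinite k]

theorem isIrreducible_univ_aff : IsIrreducible (Set.univ : Set (Aff k ι)) := by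
  refine ⟨⟨fun _ => 0, trivial⟩, ?_⟩
  rw [isPreirreducible_iff_isClosed_union_isClosed]
  intro Y Z hY hZ h
  obtain ⟨S, rfl⟩ := isClosed_aff_iff.mp hY
  obtain ⟨T, rfl⟩ := isClosed_aff_iff.mp hZ
  by_contra! hc
  simp only [Set.not_subset, zeros, Set.mem_ofPred_eq] at hc
  push Not at hc
  obtain ⟨⟨v, _, f, hf, hfv⟩, w, _, g, hg, hgw⟩ := hc
  have hfg : f * g ≠ 0 := by
    refine mul_ne_zero ?_ ?_
    · rintro rfl
      exact hfv (map_zero _)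
    · rintro rfl
      exact hgw (map_zero _)
  apply hfg
  refine MvPolynomial.funext fun u => ?_
  rw [map_mul, map_zero, mul_eq_zero]
  exact (h (Set.mem_univ u)).imp (fun h => h f hf) (fun h => h g hg)

/-- The complement of some coordinate hyperplanes. -/
def nonzeroSet (J : Set ι) : Set (Aff k ι) := {v | ∀ j ∈ J, v j ≠ 0}

theorem isIrreducible_nonzeroSet [Finite ι] (J : Set ι) :
    IsIrreducible (nonzeroSet J : Set (Aff k ι)) := by
  have hopen : IsOpen (nonzeroSet J : Set (Aff k ι)) := by
    have : (nonzeroSet J : Set (Aff k ι)) =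
        ⋂ j : J, (zeros k {MvPolynomial.X (j : ι)} : Set (Aff k ι))ᶜ := by
      ext v
      simp [nonzeroSet, zeros]
    rw [this]
    exact isOpen_iInter_of_finite fun j => (isClosed_aff_iff.mpr ⟨_, rfl⟩).isOpen_compl
  exact ⟨⟨fun _ => 1, fun _ _ => one_ne_zero⟩,
    isIrreducible_univ_aff.isPreirreducible.open_subset hopen (Set.subset_univ _)⟩

open Classical in
/-- The projection onto the linear subspace on which the coordinates in `I` are equal to `1`. -/
def fixOne (I : Set ι) (v : Aff k ι) : Aff k ι := fun j => if j ∈ I then 1 else v j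

theorem fixOne_eq_self {I : Set ι} {v : Aff k ι} (h : ∀ j ∈ I, v j = 1) : fixOne I v = v := by
  funext j
  by_cases hj : j ∈ I
  · simp [fixOne, hj, h j hj]
  · simp [fixOne, hj]

theorem mapsTo_fixOne (I J : Set ι) :
    Set.MapsTo (fixOne I) (nonzeroSet J : Set (Aff k ι)) (nonzeroSet J) := by
  intro v hv j hj
  by_cases h : j ∈ I
  · simp [fixOne, h]
  · simpa [fixOne, h] using hv j hj

theorem continuousOn_fixOne (I : Set ι) (S : Set (Aff k ι)) : ContinuousOn (fixOne I) S := by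
  refine IsRational.continuousOn fun j => ?_
  by_cases h : j ∈ I
  · simpa [fixOne, h] using IsRational.const 1
  · simpa [fixOne, h] using IsRational.coord j

/-- The closed irreducible subset of `nonzeroSet J` on which the coordinates in `I` are `1`. -/
def flagClosed [Finite ι] (I J : Set ι) :
    TopologicalSpace.IrreducibleCloseds (nonzeroSet J : Set (Aff k ι)) where
  carrier := {v | ∀ j ∈ I, (v : Aff k ι) j = 1}
  isIrreducible' := by
    have := Subtype.irreducibleSpace (isIrreducible_nonzeroSet (k := k) J)
    have h1 : Continuous ((mapsTo_fixOne (k := k) I J).restrict _ _ _) :=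
      (continuousOn_fixOne I _).mapsToRestrict (mapsTo_fixOne I J)
    have h2 := (IrreducibleSpace.isIrreducible_univ (nonzeroSet J : Set (Aff k ι))).image _
      h1.continuousOn
    convert h2 using 1
    ext v
    simp only [Set.image_univ, Set.mem_range, Set.mem_ofPred_eq]
    constructor
    · intro h
      exact ⟨v, Subtype.ext (fixOne_eq_self h)⟩
    · rintro ⟨w, rfl⟩ j hj
      simp [fixOne, hj]
  isClosed' := by
    have h1 : IsClosed ({v | ∀ j ∈ I, v j = 1} : Set (Aff k ι)) := by
      refine isClosed_aff_iff.mpr ⟨{f | ∃ j ∈ I, f = MvPolynomial.X j - 1}, ?_⟩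
      ext v
      simp only [zeros, Set.mem_ofPred_eq]
      constructor
      · rintro h _ ⟨j, hj, rfl⟩
        simp [h j hj]
      · intro h j hj
        have := h _ ⟨j, hj, rfl⟩
        simpa [sub_eq_zero] using this
    exact h1.preimage continuous_subtype_val

theorem mem_flagClosed [Finite ι] {I J : Set ι} {v : (nonzeroSet J : Set (Aff k ι))} :
    v ∈ (flagClosed I J : TopologicalSpace.IrreducibleCloseds (nonzeroSet J : Set (Aff k ι))) ↔
      ∀ j ∈ I, (v : Aff k ι) j = 1 := Iff.rfl

/-- The lower bound is a flag obtained by freeing one coordinate at a time. Fixed coordinates are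
`1` rather than `0` so that the flag stays off the coordinate hyperplanes. -/
theorem topologicalKrullDim_nonzeroSet [Finite ι] (h2 : (2 : k) ≠ 0) (J : Set ι) :
    topologicalKrullDim (nonzeroSet J : Set (Aff k ι)) = (Nat.card ι : WithBot ℕ∞) := by
  classical
  refine le_antisymm ((topologicalKrullDim_subspace_le _ _).trans topologicalKrullDim_aff_le) ?_
  let ε : ι ≃ Fin (Nat.card ι) := Finite.equivFin ι
  have hlt : StrictMono fun l : Fin (Nat.card ι + 1) =>
      (flagClosed {j | (l : ℕ) ≤ (ε j : ℕ)} J :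
        TopologicalSpace.IrreducibleCloseds (nonzeroSet J : Set (Aff k ι))) := by
    refine Fin.strictMono_iff_lt_succ.mpr fun l => ?_
    rw [lt_iff_le_not_ge]
    constructor
    · intro v hv
      rw [mem_flagClosed] at hv ⊢
      intro j hj
      refine hv j ?_
      simp only [Fin.val_succ, Fin.val_castSucc, Set.mem_ofPred_eq] at hj ⊢
      omega
    · intro h
      obtain ⟨j, hj⟩ := ε.surjective l
      -- The value `-1` is nonzero and differs from `1`, so this point separates consecutive members
      -- of the flag.
      have hw : (fun i => if i = j then -1 else 1 : Aff k ι) ∈ nonzeroSet J := by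
        intro i _
        by_cases hi : i = j <;> simp [hi]
      have h3 : (⟨_, hw⟩ : (nonzeroSet J : Set (Aff k ι))) ∈
          (flagClosed {j | ((l.succ : Fin _) : ℕ) ≤ (ε j : ℕ)} J :
            TopologicalSpace.IrreducibleCloseds (nonzeroSet J : Set (Aff k ι))) := by
        rw [mem_flagClosed]
        intro i hi
        have : i ≠ j := by
          rintro rfl
          simp [hj] at hi
        simp [this]
      have h4 := mem_flagClosed.mp (h h3) j (by simp [hj])
      simp only [if_true] at h4
      apply h2
      linear_combination -h4
  exact Order.LTSeries.length_le_krullDim (LTSeries.mk (Nat.card ι) _ hlt)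

end ZariskiTopology

/-! ### Dimension is invariant under birational bijections. -/

section Dimension

variable {k : Type*} [Field k] {p : ℕ} [Fact p.Prime] [CharP k p] {ι : Type*}

/-- A parametrization of `O` by rational functions that has a rational inverse preserves the
dimension. -/
theorem dim_eq_of_isRational {O : Set (Module.Dual k (W k p))} {S : Set (Aff k ι)}
    (F : Aff k ι → Module.Dual k (W k p)) (G : Aff k (Fin p) → Aff k ι)
    (hFO : ∀ v ∈ S, F v ∈ O) (hOF : ∀ χ ∈ O, ∃ v ∈ S, F v = χ)
    (hGF : ∀ v ∈ S, G (coords (F v)) = v)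
    (hF : ∀ n, IsRational S fun v => coords (F v) n)
    (hG : ∀ j, IsRational (coords '' O : Set (Aff k (Fin p))) fun u => G u j) :
    dim O = topologicalKrullDim S := by
  let _ : TopologicalSpace O :=
    TopologicalSpace.induced (fun χ : O => coords (χ : Module.Dual k (W k p))) (zariski k (Fin p))
  have hGS : ∀ χ ∈ O, G (coords χ) ∈ S := by
    intro χ hχ
    obtain ⟨v, hv, rfl⟩ := hOF χ hχ
    rwa [hGF v hv]
  have hFG : ∀ χ ∈ O, F (G (coords χ)) = χ := by
    intro χ hχ
    obtain ⟨v, hv, rfl⟩ := hOF χ hχ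
    rw [hGF v hv]
  have hcO : Continuous (fun χ : O => (coords (χ : Module.Dual k (W k p)) : Aff k (Fin p))) :=
    continuous_induced_dom
  let Φ : O ≃ₜ S :=
    { toFun := fun χ => ⟨G (coords (χ : Module.Dual k (W k p))), hGS χ χ.2⟩
      invFun := fun v => ⟨F v, hFO v v.2⟩
      left_inv := fun χ => Subtype.ext (hFG χ χ.2)
      right_inv := fun v => Subtype.ext (hGF v v.2)
      continuous_toFun := by
        refine Continuous.subtype_mk ?_ _
        exact (IsRational.continuousOn hG).comp_continuous hcO fun χ => ⟨χ, χ.2, rfl⟩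
      continuous_invFun := by
        refine continuous_induced_rng.mpr ?_
        exact (IsRational.continuousOn (F := fun v => (coords (F v) : Aff k (Fin p)))
          hF).comp_continuous continuous_subtype_val fun v => v.2 }
  exact IsHomeomorph.topologicalKrullDim_eq _ Φ.isHomeomorph

end Dimension

/-! ### Rational parametrization of the orbits. -/

section OrbitDimension

variable {k : Type*} [Field k] {p : ℕ} [Fact p.Prime] [CharP k p] {ι : Type*}

/-- A family of elements of `A(1)` whose coefficients are rational functions. -/
def IsRationalFamily (S : Set (Aff k ι)) (a : Aff k ι → TruncPoly k p) : Prop :=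
  ∀ n, IsRational S fun v => cf n (a v)

namespace IsRationalFamily

variable {S : Set (Aff k ι)} {a b : Aff k ι → TruncPoly k p}

theorem const (c : TruncPoly k p) : IsRationalFamily S fun _ => c := fun _ => IsRational.const _

theorem mul (ha : IsRationalFamily S a) (hb : IsRationalFamily S b) :
    IsRationalFamily S fun v => a v * b v := by
  intro n
  rcases Nat.lt_or_ge n p with hn | hn
  · simp only [cf_mul hn]
    exact IsRational.sum _ fun m _ => (ha _).mul (hb _)
  · simp only [cf_of_le hn]
    exact IsRational.const 0

theorem pow (ha : IsRationalFamily S a) (n : ℕ) : IsRationalFamily S fun v => a v ^ n := by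
  induction n with
  | zero => simpa using const 1
  | succ n ih => simpa only [pow_succ] using ih.mul ha

theorem smul {c : Aff k ι → k} (hc : IsRational S c) (ha : IsRationalFamily S a) :
    IsRationalFamily S fun v => c v • a v := by
  intro n
  simp only [map_smul, smul_eq_mul]
  exact hc.mul (ha n)

theorem sum_smul {c : ℕ → Aff k ι → k} (N : ℕ) (hc : ∀ j, IsRational S (c j)) :
    IsRationalFamily S fun v => ∑ j ∈ Finset.range N, c j v • x k p ^ j := by
  intro n
  simp only [map_sum]
  exact IsRational.sum _ fun j _ => smul (hc j) (const _) n

end IsRationalFamily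

/-- The element `q` of `A(1)` such that `chi q` has given coordinates. -/
def ofCoords (u : Aff k (Fin p)) : TruncPoly k p :=
  ∑ j ∈ Finset.range p, (if h : p - 1 - j < p then u ⟨p - 1 - j, h⟩ else 0) • x k p ^ j

theorem ofCoords_coords (q : TruncPoly k p) : ofCoords (coords (chi q)) = q := by
  refine cf_ext fun n hn => ?_
  rw [ofCoords, cf_sum_smul hn, if_pos hn, dif_pos (by omega), coords, chi_basis]
  congr 2
  simp only
  omega

theorem isRationalFamily_ofCoords (S : Set (Aff k (Fin p))) : IsRationalFamily S ofCoords := by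
  refine IsRationalFamily.sum_smul p fun j => ?_
  by_cases h : p - 1 - j < p
  · simpa only [h, dif_pos] using IsRational.coord _
  · simpa only [h, dif_neg, not_false_eq_true] using IsRational.const 0

/-- The square root `r` with constant term `1` of the quotient of `q` by `x ^ n` and the leading
coefficient. -/
def sqrtUnit (n : ℕ) (q : TruncPoly k p) : TruncPoly k p :=
  ((cf n q)⁻¹ • ∑ j ∈ Finset.range (p - n), cf (n + j) q • x k p ^ j) ^ ((p + 1) / 2)

theorem cf_sqrtUnit (hp : 3 < p) {n : ℕ} (hn : n < p) {α : k} (hα : α ≠ 0) {r : TruncPoly k p}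
    (hr : cf 0 r = 1) {j : ℕ} (hj : n + j < p) :
    cf j (sqrtUnit n (α • (x k p ^ n * r ^ 2))) = cf j r := by
  set q := α • (x k p ^ n * r ^ 2) with hq
  have hαq : cf n q = α := cf_smul_sq hn hr
  obtain ⟨w, hw⟩ : ∃ w, w = (cf n q)⁻¹ • ∑ j ∈ Finset.range (p - n), cf (n + j) q • x k p ^ j :=
    ⟨_, rfl⟩
  have hcw : ∀ m, n + m < p → cf m w = cf m (r ^ 2) := by
    intro m hm
    rw [hw, map_smul, cf_sum_smul (by omega), if_pos (by omega), hαq, hq, map_smul,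
      cf_x_pow_mul hm, if_pos (by omega), Nat.add_sub_cancel_left, smul_eq_mul, smul_eq_mul,
      inv_mul_cancel_left₀ hα]
  have hw0 : cf 0 w = 1 := by rw [hcw 0 (by omega), cf_zero_pow, hr, one_pow]
  have hxw : x k p ^ n * w = x k p ^ n * r ^ 2 := by
    refine cf_ext fun m hm => ?_
    rw [cf_x_pow_mul hm, cf_x_pow_mul hm]
    split_ifs with h
    · exact hcw _ (by omega)
    · rfl
  have h1 : sqrtUnit n q = w ^ ((p + 1) / 2) := by rw [sqrtUnit, hw]
  refine (smul_sq_unique hp hn hα (r := sqrtUnit n q) ?_ hr (α' := α) ?_).2 j hj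
  · rw [h1, cf_zero_pow, hw0, one_pow]
  · rw [h1, exists_sq_eq hp hw0, hxw]

theorem isRationalFamily_sqrtUnit {S : Set (Aff k ι)} {n : ℕ} {q : Aff k ι → TruncPoly k p}
    (hq : IsRationalFamily S q) (h0 : ∀ v ∈ S, cf n (q v) ≠ 0) :
    IsRationalFamily S fun v => sqrtUnit n (q v) :=
  (IsRationalFamily.smul ((hq n).inv h0) (IsRationalFamily.sum_smul _ fun _ => hq _)).pow _

variable [Infinite k]

/-- The dimension of a set of functionals `chi (α x ^ n r ^ 2)`, where `α` and the coefficient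
of `x ^ s` in `r` are monomials in a nonzero parameter `z`, and the other coefficients of `r` are
arbitrary. -/
theorem dim_of_smul_sq (hp : 3 < p) {n s : ℕ} (hn : n < p) (hs : 0 < s)
    {O : Set (Module.Dual k (W k p))} (e : ℤ) (f g h : ℕ) (B C : k)
    (hz : ∀ z : k, z ≠ 0 → C * (z ^ e) ^ g * (B * z ^ f) ^ h = z) (hh : n + s < p ∨ h = 0)
    (hO : ∀ q, chi q ∈ O ↔ ∃ (z : k) (r : TruncPoly k p), z ≠ 0 ∧ cf 0 r = 1 ∧
      (n + s < p → cf s r = B * z ^ f) ∧ q = z ^ e • (x k p ^ n * r ^ 2)) :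
    dim O = (Nat.card {j : Fin (p - n) // (j : ℕ) ≠ s} : WithBot ℕ∞) := by
  classical
  let ι := {j : Fin (p - n) // (j : ℕ) ≠ s}
  -- As `r` has constant term `1`, slot `0` is available for the parameter `z`. Slot `s` is removed
  -- because that coefficient is a function of `z`; if `s ≥ p - n` nothing is removed.
  let i₀ : ι := ⟨⟨0, by omega⟩, by simp only; omega⟩
  let c : ℕ → Aff k ι → k := fun j v => if j = 0 then 1 else if hs : j = s then B * v i₀ ^ f else
    if hj : j < p - n then v ⟨⟨j, hj⟩, hs⟩ else 0
  let ρ : Aff k ι → TruncPoly k p := fun v => ∑ j ∈ Finset.range (p - n), c j v • x k p ^ j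
  let F : Aff k ι → TruncPoly k p := fun v => v i₀ ^ e • (x k p ^ n * ρ v ^ 2)
  -- The inverse reads the coefficients of `r` off the polynomial square root and recovers `z` as a
  -- monomial in the leading coefficient and the residue, by `hz`. When the residue is truncated
  -- away, `hh` forces `h = 0`.
  let G : Aff k (Fin p) → Aff k ι := fun u j => if (j : ℕ) = 0 then
    C * cf n (ofCoords u) ^ g * cf s (sqrtUnit n (ofCoords u)) ^ h else
    cf j (sqrtUnit n (ofCoords u))
  let S : Set (Aff k ι) := nonzeroSet {i₀}
  have hcf : ∀ v j, n + j < p → cf j (ρ v) = c j v := by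
    intro v j hj
    change cf j (∑ j ∈ Finset.range (p - n), c j v • x k p ^ j) = _
    rw [cf_sum_smul (by omega), if_pos (by omega)]
  have hc0 : ∀ v, cf 0 (ρ v) = 1 := fun v => by rw [hcf v 0 (by omega)]; simp [c]
  have hcs : ∀ v, n + s < p → cf s (ρ v) = B * v i₀ ^ f := fun v hlt => by
    rw [hcf v s hlt]; simp [c, hs.ne']
  have hcρ : IsRationalFamily S ρ := by
    refine IsRationalFamily.sum_smul _ fun j => ?_
    by_cases h0 : j = 0
    · simpa only [c, h0, if_true] using IsRational.const 1
    by_cases h1 : j = s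
    · simpa only [c, h1, hs.ne', if_false, dif_pos] using
        (IsRational.const B).mul ((IsRational.coord i₀).pow f)
    by_cases h2 : j < p - n
    · simpa only [c, h0, if_false, h1, dif_neg, h2, dif_pos, not_false_eq_true] using
        IsRational.coord _
    · simpa only [c, h0, if_false, h1, dif_neg, h2, not_false_eq_true] using IsRational.const 0
  have hne : ∀ u ∈ (coords '' O : Set (Aff k (Fin p))), cf n (ofCoords u) ≠ 0 := by
    rintro _ ⟨χ, hχ, rfl⟩
    obtain ⟨q, rfl⟩ := chi_surjective χ
    obtain ⟨z, r, hz0, hr, -, hq⟩ := (hO q).mp hχ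
    rw [ofCoords_coords, hq, cf_smul_sq hn hr]
    exact zpow_ne_zero e hz0
  have h2 : (2 : k) ≠ 0 := two_ne_zero_of_char hp
  rw [← topologicalKrullDim_nonzeroSet (ι := ι) h2 {i₀}]
  refine dim_eq_of_isRational (S := S) (fun v => chi (F v)) G ?_ ?_ ?_ ?_ ?_
  · intro v hv
    exact (hO _).mpr ⟨v i₀, ρ v, hv _ rfl, hc0 v, hcs v, rfl⟩
  · intro χ hχ
    obtain ⟨q, rfl⟩ := chi_surjective χ
    obtain ⟨z, r, hz0, hr, hrs, hq⟩ := (hO q).mp hχ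
    let v : Aff k ι := fun j => if (j : ℕ) = 0 then z else cf j r
    have hv0 : v i₀ = z := by simp [v, i₀]
    refine ⟨v, ?_, ?_⟩
    · rintro _ rfl
      rwa [hv0]
    · congr 1
      change v i₀ ^ e • (x k p ^ n * ρ v ^ 2) = q
      have h3 : x k p ^ n * ρ v = x k p ^ n * r := by
        refine cf_ext fun m hm => ?_
        rw [cf_x_pow_mul hm, cf_x_pow_mul hm]
        split_ifs with hnm
        · rw [hcf v _ (by omega)]
          by_cases h0 : m - n = 0
          · rw [h0, hr]; simp [c]
          by_cases h1 : m - n = s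
          · simp only [c, h1, hs.ne', if_false, dif_pos, hv0]
            exact (hrs (by omega)).symm
          · simp only [c, h0, if_false, h1, dif_neg, not_false_eq_true,
              show m - n < p - n by omega, dif_pos, v]
        · rfl
      rw [hv0, hq]
      congr 1
      linear_combination (ρ v + r) * h3
  · intro v hv
    have hv0 : v i₀ ≠ 0 := hv _ rfl
    have hα : v i₀ ^ e ≠ 0 := zpow_ne_zero e hv0
    funext j
    change (if (j : ℕ) = 0 then C * cf n (ofCoords (coords (chi (F v)))) ^ g *
      cf s (sqrtUnit n (ofCoords (coords (chi (F v))))) ^ h else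
      cf j (sqrtUnit n (ofCoords (coords (chi (F v)))))) = v j
    rw [ofCoords_coords]
    split_ifs with h0
    · have hj : j = i₀ := Subtype.ext (Fin.ext h0)
      rw [hj, show cf n (F v) = v i₀ ^ e from cf_smul_sq hn (hc0 v)]
      refine Eq.trans ?_ (hz _ hv0)
      rcases hh with hlt | rfl
      · rw [cf_sqrtUnit hp hn hα (hc0 v) hlt, hcs v hlt]
      · simp
    · have hjlt := j.1.2
      rw [cf_sqrtUnit hp hn hα (hc0 v) (by omega), hcf v _ (by omega)]
      simp only [c, h0, if_false, j.2, dif_neg, not_false_eq_true, hjlt, dif_pos]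
      rfl
  · intro m
    have h3 : IsRationalFamily S F :=
      IsRationalFamily.smul ((IsRational.coord (S := S) i₀).zpow (fun v hv => hv _ rfl) e)
        ((IsRationalFamily.const _).mul (hcρ.pow 2))
    simpa only [coords, chi_basis] using h3 (p - 1 - m)
  · intro j
    have h3 := isRationalFamily_ofCoords (k := k) (p := p) (coords '' O)
    have h4 := isRationalFamily_sqrtUnit h3 hne
    by_cases h0 : (j : ℕ) = 0
    · simpa only [G, h0, if_true] using
        ((IsRational.const C).mul ((h3 n).pow g)).mul ((h4 s).pow h)
    · simpa only [G, h0, if_false] using h4 j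

end OrbitDimension

/-! ### Representatives and dimensions, height by height. -/

section Main

variable {k : Type*} [Field k] {p : ℕ} [Fact p.Prime] [CharP k p]

theorem std_zero (n s : ℕ) : std k p n s 0 = x k p ^ n := by
  rw [std, zero_smul, add_zero]

theorem x_pow_dvd_std (n s : ℕ) (a : k) : x k p ^ n ∣ std k p n s a := by
  rw [std_eq_mul]
  exact Dvd.intro _ rfl

theorem cf_std {n s : ℕ} (hn : n < p) (hs : 0 < s) (a : k) : cf n (std k p n s a) = 1 := by
  rw [std_eq_mul, cf_x_pow_mul hn, if_pos le_rfl, Nat.sub_self, cf_zero_one_add hs]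

theorem chi_std (n s : ℕ) (a : k) :
    chi (std k p n s a) = chi (x k p ^ n) + a • chi (x k p ^ (n + s)) := by
  rw [std, chi_add, chi_smul]

theorem height_chi_std {n s : ℕ} (hn : n < p) (hs : 0 < s) (a : k) :
    height (chi (std k p n s a)) = (p : ℤ) - 1 - n := by
  rw [height_chi_eq_iff hn, cf_std hn hs]
  exact ⟨x_pow_dvd_std n s a, one_ne_zero⟩

theorem chi_std_mem_orbit_iff (hp : 3 < p) {n n' : ℕ} (hn : n < p)
    (hn' : 2 * n' = n ∨ 2 * n' = n + p) (hs : 0 < p - 1 - n') (hlt : n + (p - 1 - n') < p)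
    (a a' : k) :
    chi (std k p n (p - 1 - n') a') ∈ orbit (chi (std k p n (p - 1 - n') a)) ↔
      ∃ c : k, c ≠ 0 ∧ c ^ (p - 1 - n) = c ∧ a' = a * c ^ (p - 1 - n') := by
  constructor
  · intro h
    obtain ⟨α, b, r, h1, h2, h3, h4, h5, h6⟩ := mem_orbit_std_imp hp hn hn' hs h
    obtain ⟨r₀, g1, g2, g3⟩ := std_eq_smul_sq hp n hs (by omega) a'
    obtain ⟨rfl, h7⟩ := smul_sq_unique hp hn one_ne_zero g1 h4 (g3.symm.trans h6)
    refine ⟨b, h2, by rwa [one_mul] at h3, ?_⟩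
    have h8 := h7 _ hlt
    rw [g2, h5] at h8
    have := two_ne_zero_of_char (k := k) hp
    field_simp at h8
    rw [h8, mul_comm]
  · rintro ⟨c, h1, h2, rfl⟩
    have := mem_orbit_scale (s := p - 1 - n') hp hn (α := 1) (β := a) h1 (by rwa [mul_one])
    rwa [one_smul, inv_one, mul_one] at this

variable [IsAlgClosed k]

/-- Two normal forms are conjugate only through a scaling that fixes the leading coefficient `1`;
`hJ` expresses this ambiguity of `a` as equality of `J`-th powers. -/
theorem isOrbitRepresentatives_std (hp : 3 < p) {n n' : ℕ} (hn : n < p) (hn2 : n + 2 ≠ p)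
    (hn' : 2 * n' = n ∨ 2 * n' = n + p) (hs : 0 < p - 1 - n') (hlt : n + (p - 1 - n') < p)
    {J : ℕ} {R : Set k} (hR : IsPowRepresentatives k J R)
    (hJ : ∀ a a' : k, a ^ J = a' ^ J ↔
      ∃ c : k, c ≠ 0 ∧ c ^ (p - 1 - n) = c ∧ a' = a * c ^ (p - 1 - n')) :
    IsOrbitRepresentatives ((p : ℤ) - 1 - n)
      {χ | ∃ a ∈ R, χ = chi (std k p n (p - 1 - n') a)} := by
  constructor
  · rintro _ ⟨a, _, rfl⟩
    exact height_chi_std hn hs a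
  · intro χ hχ
    obtain ⟨q, rfl⟩ := chi_surjective χ
    obtain ⟨hd, hne⟩ := (height_chi_eq_iff hn).mp hχ
    obtain ⟨a, ha⟩ := exists_std_mem_orbit hp hn hn2 hn' hd hne
    obtain ⟨b, ⟨hbR, hb⟩, huniq⟩ := hR a
    refine ⟨_, ⟨⟨b, hbR, rfl⟩, mem_orbit_trans ha
      ((chi_std_mem_orbit_iff hp hn hn' hs hlt a b).mpr ((hJ a b).mp hb))⟩, ?_⟩
    rintro _ ⟨⟨b', hbR', rfl⟩, hmem⟩
    have h1 := (chi_std_mem_orbit_iff hp hn hn' hs hlt a b').mp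
      (mem_orbit_trans (mem_orbit_symm ha) hmem)
    rw [huniq b' ⟨hbR', (hJ a b').mpr h1⟩]

/-- The exceptional degree lies beyond the truncation, so no coefficient survives besides the
leading one. -/
theorem isOrbitRepresentatives_x_pow (hp : 3 < p) {n n' : ℕ} (hn : n < p) (hn2 : n + 2 ≠ p)
    (hn' : 2 * n' = n ∨ 2 * n' = n + p) (hs : 0 < p - 1 - n') (hge : p ≤ n + (p - 1 - n')) :
    IsOrbitRepresentatives ((p : ℤ) - 1 - n) {chi (x k p ^ n)} := by
  constructor
  · rintro _ rfl
    rw [← std_zero n (p - 1 - n')]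
    exact height_chi_std hn hs 0
  · intro χ hχ
    obtain ⟨q, rfl⟩ := chi_surjective χ
    obtain ⟨hd, hne⟩ := (height_chi_eq_iff hn).mp hχ
    obtain ⟨a, ha⟩ := exists_std_mem_orbit hp hn hn2 hn' hd hne
    rw [std, x_pow_eq_zero hge, smul_zero, add_zero] at ha
    exact ⟨_, ⟨rfl, ha⟩, fun _ h => h.1⟩

theorem isOrbitRepresentatives_one (hp : 3 < p) :
    IsOrbitRepresentatives 1 {χ | ∃ a : k, a ≠ 0 ∧ χ = chi (a • x k p ^ (p - 2))} := by
  have hn : p - 2 < p := by omega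
  have h1 : (1 : ℤ) = (p : ℤ) - 1 - ((p - 2 : ℕ) : ℤ) := by omega
  have hlead : ∀ a : k, cf (p - 2) (a • x k p ^ (p - 2)) = a := fun a => by
    rw [map_smul, cf_x_pow hn, if_pos rfl, smul_eq_mul, mul_one]
  rw [h1]
  constructor
  · rintro _ ⟨a, ha, rfl⟩
    rw [height_chi_eq_iff hn, hlead]
    exact ⟨by rw [Algebra.smul_def]; exact Dvd.intro_left _ rfl, ha⟩
  · intro χ hχ
    obtain ⟨q, rfl⟩ := chi_surjective χ
    obtain ⟨hd, hne⟩ := (height_chi_eq_iff hn).mp hχ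
    refine ⟨_, ⟨⟨_, hne, rfl⟩, mem_orbit_symm ((mem_orbit_smul_iff hp hne).mpr ⟨hd, rfl⟩)⟩, ?_⟩
    rintro _ ⟨⟨a, ha, rfl⟩, hmem⟩
    rw [((mem_orbit_smul_iff hp ha).mp (mem_orbit_symm hmem)).2]

theorem card_ne {m s : ℕ} (hs : s < m) : Nat.card {j : Fin m // (j : ℕ) ≠ s} = m - 1 := by
  classical
  have : {j : Fin m // (j : ℕ) ≠ s} = {j : Fin m // j ≠ ⟨s, hs⟩} := by
    congr 1
    funext j
    rw [Ne, Ne, Fin.ext_iff]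
  rw [this, Nat.card_eq_fintype_card, Fintype.card_subtype_compl, Fintype.card_fin,
    Fintype.card_subtype_eq]

theorem card_ne_of_le {m s : ℕ} (hs : m ≤ s) : Nat.card {j : Fin m // (j : ℕ) ≠ s} = m := by
  rw [Nat.card_congr (Equiv.subtypeUnivEquiv fun j : Fin m => by omega), Nat.card_fin]

/-- The residue is zero or invisible, so it puts no constraint on `b`, and the leading coefficient
itself is the free parameter `z`. -/
theorem dim_orbit_x_pow (hp : 3 < p) {n n' : ℕ} (hn : n < p) (hn2 : n + 2 ≠ p)
    (hn' : 2 * n' = n ∨ 2 * n' = n + p) (hs : 0 < p - 1 - n') :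
    dim (orbit (chi (x k p ^ n))) =
      (Nat.card {j : Fin (p - n) // (j : ℕ) ≠ p - 1 - n'} : WithBot ℕ∞) := by
  have : Infinite k := IsAlgClosed.instInfinite
  refine dim_of_smul_sq hp hn hs 1 0 1 0 0 1 (fun z _ => by simp) (Or.inr rfl) fun q => ?_
  have hq := mem_orbit_std_iff hp hn hn2 hn' hs (a := 0) (q := q)
  rw [std_zero] at hq
  rw [hq]
  constructor
  · rintro ⟨α, b, r, h1, h2, h3, h4, h5, h6⟩
    exact ⟨α, r, h1, h4, fun h => by rw [h5 h]; simp, by rw [zpow_one, h6]⟩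
  · rintro ⟨z, r, h1, h2, h3, h4⟩
    obtain ⟨b, hb, hb'⟩ := exists_mul_pow_eq (i := p - 1 - n) (by omega) h1
    exact ⟨z, b, r, h1, hb, hb', h2, fun h => by rw [h3 h]; simp, by rw [h4, zpow_one]⟩

theorem dim_orbit_std_odd (hp : 3 < p) {n n' : ℕ} (hn : n < p)
    (hn' : 2 * n' = n + p) (hs : 0 < p - 1 - n') {a : k} (ha : a ≠ 0) :
    dim (orbit (chi (std k p n (p - 1 - n') a))) =
      (Nat.card {j : Fin (p - n) // (j : ℕ) ≠ p - 1 - n'} : WithBot ℕ∞) := by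
  have : Infinite k := IsAlgClosed.instInfinite
  have h2 := two_ne_zero_of_char (k := k) hp
  -- The height is `2 s + 1` with `s = p - 1 - n'`, so `α = b ^ (-2 s)` and the residue is `b ^ s a
  -- / 2`. Both depend only on `z = b ^ s`, which the residue determines.
  refine dim_of_smul_sq hp hn hs (-2) 1 0 1 (2⁻¹ * a) (2⁻¹ * a)⁻¹ (fun z _ => by field_simp)
    (Or.inl (by omega)) fun q => ?_
  rw [mem_orbit_std_iff hp hn (by omega) (Or.inr hn') hs]
  have hi : p - 1 - n = (p - 1 - n') * 2 + 1 := by omega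
  rw [hi]
  constructor
  · rintro ⟨α, b, r, h1, h2, h3, h4, h5, h6⟩
    refine ⟨b ^ (p - 1 - n'), r, pow_ne_zero _ h2, h4, fun h => by rw [h5 h]; ring, ?_⟩
    rw [h6]
    congr 1
    have h7 : α * (b ^ (p - 1 - n')) ^ 2 = 1 := by
      apply mul_right_cancel₀ h2
      rw [one_mul]
      conv_rhs => rw [← h3]
      ring
    rw [zpow_neg, zpow_ofNat, eq_inv_of_mul_eq_one_left h7]
  · rintro ⟨z, r, h1, h2, h3, h4⟩
    obtain ⟨b, hb⟩ := IsAlgClosed.exists_pow_nat_eq z hs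
    have hb0 : b ≠ 0 := by
      rintro rfl
      rw [zero_pow hs.ne'] at hb
      exact h1 hb.symm
    refine ⟨z ^ (-2 : ℤ), b, r, zpow_ne_zero _ h1, hb0, ?_, h2, fun h => by
      rw [h3 h, hb]; ring, h4⟩
    rw [pow_succ, pow_mul, hb, ← mul_assoc, zpow_neg, zpow_ofNat,
      inv_mul_cancel₀ (pow_ne_zero 2 h1), one_mul]

theorem dim_orbit_std_top (hp : 3 < p) {a : k} (ha : a ≠ 0) :
    dim (orbit (chi (std k p 0 (p - 1) a))) =
      (Nat.card {j : Fin p // (j : ℕ) ≠ p - 1} : WithBot ℕ∞) := by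
  have : Infinite k := IsAlgClosed.instInfinite
  have h2 := two_ne_zero_of_char (k := k) hp
  have hpow : ∀ z : k, z ≠ 0 → z ^ (2 - (p : ℤ)) * z ^ (p - 1) = z := by
    intro z hz
    rw [← zpow_natCast, ← zpow_add₀ hz, show 2 - (p : ℤ) + ((p - 1 : ℕ) : ℤ) = 1 by omega, zpow_one]
  -- Here `z = b`: the leading coefficient is `b ^ (2 - p)`, the residue is `b ^ (p - 1) a / 2`, and
  -- their product is `b a / 2`.
  refine dim_of_smul_sq hp (n := 0) (by omega) (by omega) (2 - (p : ℤ)) (p - 1) 1 1 (2⁻¹ * a)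
    (2⁻¹ * a)⁻¹ (fun z hz => ?_) (Or.inl (by omega)) fun q => ?_
  · rw [pow_one, pow_one]
    have h3 : (2⁻¹ * a : k) ≠ 0 := mul_ne_zero (inv_ne_zero h2) ha
    linear_combination hpow z hz + (z ^ (2 - (p : ℤ)) * z ^ (p - 1)) * inv_mul_cancel₀ h3
  · have h3 := mem_orbit_std_iff (k := k) hp (n := 0) (n' := 0) (by omega) (by omega) (by omega)
      (by omega) (a := a) (q := q)
    rw [Nat.sub_zero] at h3
    rw [h3]
    constructor
    · rintro ⟨α, b, r, h1, h2, h3, h4, h5, h6⟩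
      refine ⟨b, r, h2, h4, fun h => by rw [h5 h]; ring, ?_⟩
      rw [h6]
      congr 1
      exact mul_right_cancel₀ (pow_ne_zero (p - 1) h2) (h3.trans (hpow b h2).symm)
    · rintro ⟨z, r, h1, h2, h3, h4⟩
      exact ⟨_, z, r, zpow_ne_zero _ h1, h1, hpow z h1, h2, fun h => by rw [h3 h]; ring, h4⟩

/-- The orbit is an affine line: the leading coefficient is fixed and the coefficient of `x ^ (p -
1)` is arbitrary. -/
theorem dim_orbit_one (hp : 3 < p) {a : k} (ha : a ≠ 0) :
    dim (orbit (chi (a • x k p ^ (p - 2)))) = 1 := by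
  have : Infinite k := IsAlgClosed.instInfinite
  have h2 := two_ne_zero_of_char (k := k) hp
  have hd : ∀ c : k, x k p ^ (p - 2) ∣ a • x k p ^ (p - 2) + c • x k p ^ (p - 1) := by
    intro c
    rw [Algebra.smul_def, Algebra.smul_def]
    exact dvd_add (Dvd.intro_left _ rfl) (Dvd.dvd.mul_left (pow_dvd_pow _ (by omega)) _)
  have h3 : dim (orbit (chi (a • x k p ^ (p - 2)))) =
      topologicalKrullDim (nonzeroSet ∅ : Set (Aff k Unit)) := by
    refine dim_eq_of_isRational
      (fun v : Aff k Unit => chi (a • x k p ^ (p - 2) + v () • x k p ^ (p - 1)))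
      (fun u _ => cf (p - 1) (ofCoords u)) ?_ ?_ ?_ ?_ ?_
    · intro v _
      rw [mem_orbit_smul_iff hp ha]
      refine ⟨hd _, ?_⟩
      rw [map_add, map_smul, map_smul, cf_x_pow (by omega), cf_x_pow (by omega), if_pos rfl,
        if_neg (by omega)]
      simp
    · intro χ hχ
      obtain ⟨q, rfl⟩ := chi_surjective χ
      obtain ⟨h4, h5⟩ := (mem_orbit_smul_iff hp ha).mp hχ
      refine ⟨fun _ => cf (p - 1) q, fun j hj => absurd hj (Set.notMem_empty j), ?_⟩
      congr 1
      refine cf_ext fun m hm => ?_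
      rw [map_add, map_smul, map_smul, cf_x_pow hm, cf_x_pow hm, smul_eq_mul, smul_eq_mul]
      rcases Nat.lt_or_ge m (p - 2) with h6 | h6
      · rw [if_neg (by omega), if_neg (by omega), (x_pow_dvd_iff (by omega) q).mp h4 m h6]
        simp
      · rcases Nat.eq_or_lt_of_le h6 with h7 | h7
        · rw [if_pos h7.symm, if_neg (by omega), ← h7, h5]
          simp
        · rw [if_neg (by omega), if_pos (by omega), show m = p - 1 by omega]
          simp
    · intro v _
      funext j
      rw [ofCoords_coords, map_add, map_smul, map_smul, cf_x_pow (by omega),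
        cf_x_pow (by omega), if_neg (by omega), if_pos rfl]
      simp
    · intro n
      simp only [coords, chi_basis, map_add, map_smul, smul_eq_mul]
      exact (IsRational.const _).add ((IsRational.coord ()).mul (IsRational.const _))
    · intro j
      exact isRationalFamily_ofCoords _ _
  rw [h3, topologicalKrullDim_nonzeroSet h2]
  simp

end Main

end WittAlgebra

end

/-! ### The theorem, by translation from heights and dual basis vectors to orders and monomials. -/

theorem theorem3 {k : Type*} [Field k] [IsAlgClosed k] (p : ℕ) [Fact p.Prime] [CharP k p]
    (hp : 3 < p)
    (K : ℕ → Set k) (hK : ∀ j, WittAlgebra.IsPowRepresentatives k j (K j)) :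
    -- the height is constant on orbits
    (∀ χ : Module.Dual k (WittAlgebra.W k p), ∀ ψ ∈ WittAlgebra.orbit χ,
      WittAlgebra.height ψ = WittAlgebra.height χ) ∧
    -- representatives of the orbits of each height
    WittAlgebra.IsOrbitRepresentatives 1
      {χ | ∃ a : k, a ≠ 0 ∧ χ = a • WittAlgebra.e' k p 0} ∧
    (∀ i : ℕ, i ≤ p - 3 → Even i →
      WittAlgebra.IsOrbitRepresentatives (i : ℤ) {WittAlgebra.e' k p ((i : ℤ) - 1)}) ∧
    (∀ i : ℕ, 3 ≤ i → i ≤ p - 2 → Odd i →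
      WittAlgebra.IsOrbitRepresentatives (i : ℤ)
        {χ | ∃ a ∈ K 2, χ = WittAlgebra.e' k p ((i : ℤ) - 1)
          + a • WittAlgebra.e' k p (((i : ℤ) - 1) / 2)}) ∧
    WittAlgebra.IsOrbitRepresentatives ((p : ℤ) - 1)
      {χ | ∃ a ∈ K (p - 2), χ = WittAlgebra.e' k p ((p : ℤ) - 2)
        + a • WittAlgebra.e' k p (-1)} ∧
    -- dimensions of the orbits
    (∀ a : k, a ≠ 0 →
      WittAlgebra.dim (WittAlgebra.orbit (a • WittAlgebra.e' k p 0)) = 1) ∧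
    (∀ i : ℕ, i ≤ p - 3 → Even i →
      WittAlgebra.dim (WittAlgebra.orbit (WittAlgebra.e' k p ((i : ℤ) - 1)))
        = ((i + 1 : ℕ) : WithBot ℕ∞)) ∧
    (∀ i : ℕ, 3 ≤ i → i ≤ p - 2 → Odd i → ∀ a : k,
      WittAlgebra.dim (WittAlgebra.orbit (WittAlgebra.e' k p ((i : ℤ) - 1)
          + a • WittAlgebra.e' k p (((i : ℤ) - 1) / 2)))
        = (i : WithBot ℕ∞)) ∧
    (∀ a : k,
      WittAlgebra.dim (WittAlgebra.orbit (WittAlgebra.e' k p ((p : ℤ) - 2)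
          + a • WittAlgebra.e' k p (-1)))
        = ((p - 1 : ℕ) : WithBot ℕ∞)) := by
  open WittAlgebra in
  have hodd : p % 2 = 1 := (Fact.out : p.Prime).eq_two_or_odd.resolve_left (by omega)
  have he0 : ∀ a : k, a • e' k p 0 = chi (a • x k p ^ (p - 2)) := fun a => by
    rw [e'_eq_chi (m := 1) (by norm_num) (by omega), chi_smul, Nat.sub_sub]
  have heven : ∀ i : ℕ, i ≤ p - 3 → e' k p ((i : ℤ) - 1) = chi (x k p ^ (p - 1 - i)) :=
    fun i hi => e'_eq_chi rfl (by omega)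
  have hoddc : ∀ m : ℕ, 2 * m + 1 ≤ p - 2 → ∀ a : k,
      e' k p (((2 * m + 1 : ℕ) : ℤ) - 1) + a • e' k p ((((2 * m + 1 : ℕ) : ℤ) - 1) / 2) =
        chi (std k p (p - 2 - 2 * m) (p - 1 - (p - 1 - m)) a) := fun m hm a => by
    rw [e'_eq_chi (m := 2 * m + 1) rfl (by omega), e'_eq_chi (m := m + 1) (by push_cast; omega)
      (by omega), chi_std, show p - 1 - (2 * m + 1) = p - 2 - 2 * m by omega,
      show p - 1 - (m + 1) = p - 2 - 2 * m + (p - 1 - (p - 1 - m)) by omega]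
  have htop : ∀ a : k, e' k p ((p : ℤ) - 2) + a • e' k p (-1) = chi (std k p 0 (p - 1) a) :=
    fun a => by
      rw [e'_eq_chi (m := p - 1) (by omega) (by omega), e'_eq_chi (m := 0) (by norm_num) (by omega),
        chi_std, Nat.sub_self, Nat.sub_zero, zero_add]
  refine ⟨fun χ ψ h => height_eq_of_mem_orbit hp h, ?_, ?_, ?_, ?_, ?_, ?_, ?_, ?_⟩
  · simp only [he0]
    exact isOrbitRepresentatives_one hp
  · rintro i hi ⟨m, rfl⟩
    rw [heven _ hi]
    have h1 := isOrbitRepresentatives_x_pow (k := k) hp (n := p - 1 - (m + m))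
      (n' := (p - 1) / 2 - m) (by omega) (by omega) (by omega) (by omega) (by omega)
    rwa [show (p : ℤ) - 1 - ((p - 1 - (m + m) : ℕ) : ℤ) = ((m + m : ℕ) : ℤ) by omega] at h1
  · rintro i h3 hi ⟨m, rfl⟩
    simp only [hoddc m hi]
    have h1 := isOrbitRepresentatives_std (k := k) hp (n := p - 2 - 2 * m) (n' := p - 1 - m)
      (by omega) (by omega) (by omega) (by omega) (by omega) (hK 2) (fun a a' => by
        rw [show p - 1 - (p - 2 - 2 * m) = m * 2 + 1 by omega,
          show p - 1 - (p - 1 - m) = m by omega]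
        constructor
        · intro h
          rcases sq_eq_sq_iff_eq_or_eq_neg.mp h with rfl | rfl
          · exact ⟨1, one_ne_zero, by simp, by simp⟩
          -- Scalings with `c ^ (2 m + 1) = c` act on `a` through `c ^ m = ± 1`, and the sign `-1`
          -- does occur.
          · obtain ⟨c, hc⟩ := IsAlgClosed.exists_pow_nat_eq (-1 : k) (n := m) (by omega)
            refine ⟨c, ?_, ?_, ?_⟩
            · rintro rfl
              rw [zero_pow (by omega)] at hc
              simp at hc
            · rw [pow_succ, pow_mul, hc]
              simp
            · rw [hc]
              simp
        · rintro ⟨c, h1, h2, rfl⟩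
          have h3 : (c ^ m) ^ 2 = 1 := by
            rw [← pow_mul]
            apply mul_right_cancel₀ h1
            rw [← pow_succ, h2, one_mul]
          rw [mul_pow, h3, mul_one])
    rwa [show (p : ℤ) - 1 - ((p - 2 - 2 * m : ℕ) : ℤ) = ((2 * m + 1 : ℕ) : ℤ) by omega] at h1
  · simp only [htop]
    have h1 := isOrbitRepresentatives_std (k := k) hp (n := 0) (n' := 0)
      (by omega) (by omega) (by omega) (by omega) (by omega) (hK (p - 2)) (fun a a' => by
        rw [Nat.sub_zero]
        constructor
        · intro h
          rcases eq_or_ne a 0 with rfl | ha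
          · rw [zero_pow (by omega)] at h
            exact ⟨1, one_ne_zero, by simp, by simpa using eq_zero_of_pow_eq_zero h.symm⟩
          -- At the top height the admissible `c` satisfy `c ^ (p - 2) = 1` and act by `a ↦ a c ^ (p
          -- - 1) = a c`, so the ratio itself is the scaling.
          · have h2 : (a' / a) ^ (p - 1) = a' / a := by
              rw [show p - 1 = p - 2 + 1 by omega, pow_succ, div_pow, h,
                div_self (by rw [← h]; exact pow_ne_zero _ ha), one_mul]
            refine ⟨a' / a, ?_, h2, by rw [h2, mul_div_cancel₀ _ ha]⟩
            apply div_ne_zero _ ha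
            rintro rfl
            rw [zero_pow (by omega)] at h
            exact pow_ne_zero _ ha h
        · rintro ⟨c, h1, h2, rfl⟩
          have h3 : c ^ (p - 2) = 1 := by
            apply mul_right_cancel₀ h1
            rw [← pow_succ, one_mul, show p - 2 + 1 = p - 1 by omega, h2]
          rw [h2, mul_pow, h3, mul_one])
    simpa only [Nat.sub_zero, Nat.cast_zero, sub_zero] using h1
  · intro a ha
    rw [he0]
    exact dim_orbit_one hp ha
  · rintro i hi ⟨m, rfl⟩
    rw [heven _ hi, dim_orbit_x_pow (k := k) hp (n := p - 1 - (m + m))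
      (n' := (p - 1) / 2 - m) (by omega) (by omega) (by omega) (by omega),
      card_ne_of_le (by omega)]
    congr 1
    omega
  · rintro i h3 hi ⟨m, rfl⟩ a
    rw [hoddc m hi]
    rcases eq_or_ne a 0 with rfl | ha
    · rw [std_zero, dim_orbit_x_pow (k := k) hp (n' := p - 1 - m) (by omega) (by omega)
        (by omega) (by omega), card_ne (by omega)]
      congr 1
      omega
    · rw [dim_orbit_std_odd hp (by omega) (by omega) (by omega) ha, card_ne (by omega)]
      congr 1
      omega
  · intro a
    rw [htop]
    rcases eq_or_ne a 0 with rfl | ha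
    · rw [std_zero, dim_orbit_x_pow (k := k) hp (n' := 0) (by omega) (by omega)
        (by omega) (by omega), card_ne (by omega)]
      congr 1
    · rw [dim_orbit_std_top hp ha, card_ne (by omega)]
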